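/- Write $\mathbb N=\{1,2,3,\dots\}$ and let $\mathcal P$ be the set of primes. For $f,g:\mathbb N^2\to\mathbb C$ let $$(f*g)(n_1,n_2)=\sum_{d_1\mid n_1,\ d_2\mid n_2} f(d_1,d_2)\,g(n_1/d_1,n_2/d_2)$$ be the Dirichlet convolution, whose identity is $\delta$, with $\delta(1,1)=1$ and $\delta(n_1,n_2)=0$ otherwise. Let $\mathbf 1$ be the constant function $1$ on $\mathbb N^2$. For $k\in\mathbb N$ let $\tau_k=\mathbf 1*\cdots*\mathbf 1$ ($k$ factors) and $\tilde\tau_k=\mathbf 1*\cdots*\mathbf 1*\gcd$ ($k-1$ factors $\mathbf 1$, so that $\tilde\tau_1=\gcd$), and let $\mu_k$ and $\tilde\mu_k$ be the Dirichlet inverses of $\tau_k$ and $\tilde\tau_k$. A function $f:\mathbb N^2\to\mathbb C$ is called multiplicative if $f(m_1n_1,m_2n_2)=f(m_1,m_2)f(n_1,n_2)$ whenever $\gcd(m_1m_2,n_1n_2)=1$. **Theorem 3.** Let $f:\mathbb N^2\to\mathbb C$ be multiplicative and let $k\in\mathbb N$. (i) Suppose that $$\sum_{p\in\mathcal P}\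 \sum_{\substack{\nu_1,\nu_2\ge 0\\ \nu_1+\nu_2\ge 1}}\frac{|(f*\mu_k)(p^{\nu_1},p^{\nu_2})|}{p^{\nu_1+\nu_2}}<\infty .$$ Then $$\lim_{x,y\to\infty}\frac{1}{xy(\log x\log y)^{k-1}}\sum_{n_1\le x,\ n_2\le y}f(n_1,n_2)=\frac{1}{((k-1)!)^2}\prod_{p\in\mathcal P}\Bigl(1-\frac1p\Bigr)^{2k}\Bigl(\sum_{\nu_1,\nu_2\ge 0}\frac{f(p^{\nu_1},p^{\nu_2})}{p^{\nu_1+\nu_2}}\Bigr),$$ where the limit is taken as $x$ and $y$ tend to infinity independently. (ii) Suppose that $$\sum_{p\in\mathcal P}\ \sum_{\substack{\nu_1,\nu_2\ge 0\\ \nu_1+\nu_2\ge 1}}\frac{|(f*\tilde\mu_k)(p^{\nu_1},p^{\nu_2})|}{p^{\nu_1+\nu_2}}<\infty .$$ Then $$\lim_{x\to\infty}\frac{1}{x^2(\log x)^{2k-1}}\sum_{n_1,n_2\le x}f(n_1,n_2)=\frac{1}{((k-1)!)^2(2k-1)}\prod_{p\in\mathcal P}\Bigl(1-\frac1p\Bigr)^{2k+1}\Bigl(\sum_{\nu_1,\nu_2\ge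 0}\frac{f(p^{\nu_1},p^{\nu_2})}{p^{\nu_1+\nu_2}}\Bigr).$$ In both parts the double series over $\nu_1,\nu_2$ converge absolutely and the infinite product over $p$ converges (unconditionally, the value $0$ being allowed). -/

import Mathlib

open Filter Topology

noncomputable section

/-- Arithmetic functions of two variables. An element `f` is a function `ℕ → ℕ → ℂ` whose value is
`0` as soon as one of the arguments is `0`, that is, an arbitrary complex function of two positive
integers. The ring multiplication is the Dirichlet convolution in two variables (see
`BiArith.mul_apply_apply`) and the unit `1` is the function `δ` (see `BiArith.one_apply_apply`). -/
def BiArith : Type := ArithmeticFunction (ArithmeticFunction ℂ)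

namespace BiArith

instance : CommRing BiArith :=
  (inferInstance : CommRing (ArithmeticFunction (ArithmeticFunction ℂ)))

/-- The value of `f` at the pair `(m, n)`, written `f m n`. -/
def eval (f : BiArith) (m n : ℕ) : ℂ :=
  (DFunLike.coe (F := ArithmeticFunction (ArithmeticFunction ℂ)) f m) n

instance : CoeFun BiArith fun _ => ℕ → ℕ → ℂ := ⟨eval⟩

theorem ext {f g : BiArith} (h : ∀ m n : ℕ, f m n = g m n) : f = g :=
  ArithmeticFunction.ext fun m => ArithmeticFunction.ext fun n => h m n

theorem apply_zero_left (f : BiArith) (n : ℕ) : f 0 n = 0 :=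
  congrArg (fun F : ArithmeticFunction ℂ => F n)
    (ArithmeticFunction.map_zero (R := ArithmeticFunction ℂ) (f := f))

theorem apply_zero_right (f : BiArith) (m : ℕ) : f m 0 = 0 :=
  ArithmeticFunction.map_zero

/-- The arithmetic function of two variables given by `g` on pairs of positive integers. -/
def ofFun (g : ℕ → ℕ → ℂ) : BiArith :=
  ⟨fun a => ⟨fun b => if a = 0 ∨ b = 0 then 0 else g a b, by simp⟩, by ext b; simp⟩

theorem ofFun_apply (g : ℕ → ℕ → ℂ) {a b : ℕ} (ha : a ≠ 0) (hb : b ≠ 0) :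
    ofFun g a b = g a b := by
  change (if a = 0 ∨ b = 0 then 0 else g a b) = g a b
  simp [ha, hb]

theorem mul_apply_apply (f g : BiArith) (m n : ℕ) :
    (f * g) m n = ∑ a ∈ m.divisorsAntidiagonal, ∑ b ∈ n.divisorsAntidiagonal,
      f a.1 b.1 * g a.2 b.2 := by
  have h : ∀ (s : Finset (ℕ × ℕ)) (F : ℕ × ℕ → ArithmeticFunction ℂ),
      (∑ a ∈ s, F a) n = ∑ a ∈ s, F a n := by
    intro s F
    induction s using Finset.cons_induction with
    | empty => simp
    | cons a s ha ih => rw [Finset.sum_cons, Finset.sum_cons, ArithmeticFunction.add_apply, ih]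
  change (∑ a ∈ m.divisorsAntidiagonal,
    (DFunLike.coe (F := ArithmeticFunction (ArithmeticFunction ℂ)) f a.1) *
    (DFunLike.coe (F := ArithmeticFunction (ArithmeticFunction ℂ)) g a.2)) n = _
  rw [h]
  simp only [ArithmeticFunction.mul_apply]
  rfl

theorem one_apply_apply (m n : ℕ) : (1 : BiArith) m n = if m = 1 ∧ n = 1 then 1 else 0 := by
  change (1 : ArithmeticFunction (ArithmeticFunction ℂ)) m n = _
  by_cases hm : m = 1 <;> by_cases hn : n = 1 <;> simp [hm, hn]

theorem isUnit_of_apply_one_ne_zero (f : BiArith) (h : f 1 1 ≠ 0) : IsUnit f := by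
  refine (ArithmeticFunction.isUnit_iff_isUnit_apply_one
    (R := ArithmeticFunction ℂ) (f := f)).mpr ?_
  exact ArithmeticFunction.isUnit_iff_isUnit_apply_one.mpr (isUnit_iff_ne_zero.mpr h)

/-- The function with constant value `1` on pairs of positive integers. -/
def ones : BiArith := ofFun fun _ _ => 1

/-- The function `(n₁, n₂) ↦ gcd(n₁, n₂)`. -/
def gcdFun : BiArith := ofFun fun a b => (Nat.gcd a b : ℂ)

theorem isUnit_ones : IsUnit ones :=
  isUnit_of_apply_one_ne_zero _ (by simp [ones, ofFun_apply])

theorem isUnit_gcd : IsUnit gcdFun :=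
  isUnit_of_apply_one_ne_zero _ (by simp [gcdFun, ofFun_apply])

/-- `τ_k`, the `k`-fold Dirichlet convolution of `ones`. -/
def tau (k : ℕ) : BiArith := ones ^ k

/-- `τ̃_k` for `k ≥ 1`: the Dirichlet convolution of `k - 1` copies of `ones` and of `gcdFun`. -/
def tauTilde (k : ℕ) : BiArith := ones ^ (k - 1) * gcdFun

theorem isUnit_tau (k : ℕ) : IsUnit (tau k) := isUnit_ones.pow k

theorem isUnit_tauTilde (k : ℕ) : IsUnit (tauTilde k) := (isUnit_ones.pow (k - 1)).mul isUnit_gcd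

/-- `μ_k`, the Dirichlet inverse of `τ_k`. -/
def mu (k : ℕ) : BiArith := ((isUnit_tau k).unit⁻¹ : BiArithˣ)

/-- `μ̃_k`, the Dirichlet inverse of `τ̃_k`. -/
def muTilde (k : ℕ) : BiArith := ((isUnit_tauTilde k).unit⁻¹ : BiArithˣ)

theorem mu_mul_tau (k : ℕ) : mu k * tau k = 1 := (isUnit_tau k).val_inv_mul

theorem muTilde_mul_tauTilde (k : ℕ) : muTilde k * tauTilde k = 1 :=
  (isUnit_tauTilde k).val_inv_mul

/-- Multiplicative functions of two variables. -/
def IsMultiplicativeTwo (f : BiArith) : Prop :=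
  ∀ m₁ m₂ n₁ n₂ : ℕ, 0 < m₁ → 0 < m₂ → 0 < n₁ → 0 < n₂ → Nat.gcd (m₁ * m₂) (n₁ * n₂) = 1 →
    f (m₁ * n₁) (m₂ * n₂) = f m₁ m₂ * f n₁ n₂

/-- `∑_p ∑_{ν₁ + ν₂ ≥ 1} |g(p^ν₁, p^ν₂)| / p^(ν₁ + ν₂) < ∞`. The terms are nonnegative, so this
is summability over all triples `(p, ν₁, ν₂)`. -/
def PrimePowerSummable (g : BiArith) : Prop :=
  Summable fun q : Nat.Primes × {ν : ℕ × ℕ // 1 ≤ ν.1 + ν.2} =>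
    ‖g ((q.1 : ℕ) ^ q.2.1.1) ((q.1 : ℕ) ^ q.2.1.2)‖ / ((q.1 : ℕ) : ℝ) ^ (q.2.1.1 + q.2.1.2)

/-- The term `f(p^ν₁, p^ν₂) / p^(ν₁ + ν₂)` of the local series at `p`. -/
def localTerm (f : BiArith) (p : ℕ) (ν : ℕ × ℕ) : ℂ :=
  f (p ^ ν.1) (p ^ ν.2) / (p : ℂ) ^ (ν.1 + ν.2)

/-- `∑_{n₁ ≤ x, n₂ ≤ y} f(n₁, n₂)` for real `x`, `y`. -/
def partialSum (f : BiArith) (x y : ℝ) : ℂ :=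
  ∑ n₁ ∈ Finset.Icc 1 ⌊x⌋₊, ∑ n₂ ∈ Finset.Icc 1 ⌊y⌋₊, f n₁ n₂

end BiArith

end

/-! Both parts are a two-variable form of Wintner's mean value theorem. Write `f = g * u`, where `u`
has known summatory function `U` and the series of `g(a, b) / (ab)` converges absolutely. The sum of
`f` is then the sum of `g(a, b) U(x/a, y/b)`. After normalisation each term tends to `c g(a, b) /
(ab)` and is dominated by `C |g(a, b)| / (ab)`, so the mean value is `c` times the double series of
`g` (`tendsto_partialSum_mul`).

Absolute convergence comes from the prime powers: `g` is multiplicative, so finite sums of `|g(a,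
b)| / (ab)` are at most `∏ (1 + e_p) ≤ exp (∑ e_p)` (`PrimePowerSummable.summable_wt`). The double
series of `g` is then an Euler product, and its factor at `p` is that of `f` divided by that of `u`
(`hasProd_localTerm_of_eq_mul`).

In (i), `u = τ_k`, and `U` is a product of two one-variable divisor sums. In (ii), `gcd = diag(μ *
id) * 1` gives `τ̃_k = diag μ * (diag id * τ_k)`. The factor `diag μ` is absorbed into `g`, since `∑
|μ(n)| / n²` converges, leaving `u = diag id * τ_k`. The asymptotics of both `U` rest on
`tendsto_sum_apply_div`, which trades a sum over `d` of `F(x/d)` for one more logarithm. -/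

noncomputable section

/-! ### Convolution algebra: multiplicativity, the gcd function and explicit inverses. -/

namespace Nat.Coprime

theorem sum_divisors_mul_eq {M : Type*} [AddCommMonoid M] {m n : ℕ} (h : m.Coprime n)
    (F : ℕ → M) :
    ∑ d ∈ (m * n).divisors, F d = ∑ a ∈ m.divisors, ∑ b ∈ n.divisors, F (a * b) := by
  rw [h.divisors_mul, Finset.sum_map, ← Finset.sum_product']
  exact Finset.sum_attach (m.divisors ×ˢ n.divisors) fun p => F (p.1 * p.2)

theorem sum_divisorsAntidiagonal_mul {M : Type*} [AddCommMonoid M] {m n : ℕ} (h : m.Coprime n)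
    (F : ℕ → ℕ → M) :
    ∑ d ∈ (m * n).divisorsAntidiagonal, F d.1 d.2 =
      ∑ a ∈ m.divisorsAntidiagonal, ∑ b ∈ n.divisorsAntidiagonal, F (a.1 * b.1) (a.2 * b.2) := by
  rw [Nat.sum_divisorsAntidiagonal, h.sum_divisors_mul_eq,
    Nat.sum_divisorsAntidiagonal fun i j =>
      ∑ b ∈ n.divisorsAntidiagonal, F (i * b.1) (j * b.2)]
  refine Finset.sum_congr rfl fun a ha => ?_
  rw [Nat.sum_divisorsAntidiagonal fun i j => F (a * i) (m / a * j)]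
  refine Finset.sum_congr rfl fun b hb => ?_
  rw [Nat.mul_div_mul_comm (Nat.dvd_of_mem_divisors ha) (Nat.dvd_of_mem_divisors hb)]

end Nat.Coprime

namespace BiArith

open ArithmeticFunction

theorem zero_apply_apply (m n : ℕ) : (0 : BiArith) m n = 0 := rfl

theorem IsMultiplicativeTwo.mul {f g : BiArith} (hf : f.IsMultiplicativeTwo)
    (hg : g.IsMultiplicativeTwo) : (f * g).IsMultiplicativeTwo := by
  intro m₁ m₂ n₁ n₂ hm₁ hm₂ hn₁ hn₂ h
  have h : (m₁ * m₂).Coprime (n₁ * n₂) := h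
  have h₁ : m₁.Coprime n₁ := h.coprime_mul_right.coprime_mul_right_right
  have h₂ : m₂.Coprime n₂ := h.coprime_mul_left.coprime_mul_left_right
  simp only [mul_apply_apply]
  rw [h₁.sum_divisorsAntidiagonal_mul fun i j =>
    ∑ b ∈ (m₂ * n₂).divisorsAntidiagonal, f i b.1 * g j b.2]
  simp only [Finset.sum_mul_sum]
  refine Finset.sum_congr rfl fun a ha => Finset.sum_congr rfl fun b hb => ?_
  rw [h₂.sum_divisorsAntidiagonal_mul fun i j => f (a.1 * b.1) i * g (a.2 * b.2) j]
  refine Finset.sum_congr rfl fun c hc => Finset.sum_congr rfl fun d hd => ?_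
  have ha' := Nat.ne_zero_of_mem_divisorsAntidiagonal ha
  have hb' := Nat.ne_zero_of_mem_divisorsAntidiagonal hb
  have hc' := Nat.ne_zero_of_mem_divisorsAntidiagonal hc
  have hd' := Nat.ne_zero_of_mem_divisorsAntidiagonal hd
  rw [Nat.mem_divisorsAntidiagonal] at ha hb hc hd
  rw [← ha.1, ← hb.1, ← hc.1, ← hd.1] at h
  rw [hf _ _ _ _ (Nat.pos_of_ne_zero ha'.1) (Nat.pos_of_ne_zero hc'.1)
      (Nat.pos_of_ne_zero hb'.1) (Nat.pos_of_ne_zero hd'.1)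
      ((h.coprime_dvd_left (Nat.mul_dvd_mul (dvd_mul_right _ _) (dvd_mul_right _ _))).coprime_dvd_right
        (Nat.mul_dvd_mul (dvd_mul_right _ _) (dvd_mul_right _ _))),
    hg _ _ _ _ (Nat.pos_of_ne_zero ha'.2) (Nat.pos_of_ne_zero hc'.2)
      (Nat.pos_of_ne_zero hb'.2) (Nat.pos_of_ne_zero hd'.2)
      ((h.coprime_dvd_left (Nat.mul_dvd_mul (dvd_mul_left _ _) (dvd_mul_left _ _))).coprime_dvd_right
        (Nat.mul_dvd_mul (dvd_mul_left _ _) (dvd_mul_left _ _)))]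
  ring

theorem isMultiplicativeTwo_one : IsMultiplicativeTwo 1 := by
  intro m₁ m₂ n₁ n₂ _ _ _ _ _
  simp only [one_apply_apply, mul_eq_one]
  split_ifs <;> simp_all

theorem IsMultiplicativeTwo.pow {f : BiArith} (hf : f.IsMultiplicativeTwo) (k : ℕ) :
    (f ^ k).IsMultiplicativeTwo := by
  induction k with
  | zero => simpa using isMultiplicativeTwo_one
  | succ k ih => rw [pow_succ]; exact ih.mul hf

/-- The function `(m, n) ↦ a(m) b(n)`. -/
def outer (a b : ArithmeticFunction ℂ) : BiArith := ofFun fun m n => a m * b n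

theorem outer_apply (a b : ArithmeticFunction ℂ) (m n : ℕ) : outer a b m n = a m * b n := by
  change (if m = 0 ∨ n = 0 then 0 else a m * b n) = a m * b n
  split_ifs with h
  · rcases h with rfl | rfl <;> simp
  · rfl

theorem outer_mul_outer (a b c d : ArithmeticFunction ℂ) :
    outer a b * outer c d = outer (a * c) (b * d) := by
  refine ext fun m n => ?_
  simp only [mul_apply_apply, outer_apply, ArithmeticFunction.mul_apply, Finset.sum_mul_sum]
  exact Finset.sum_congr rfl fun i _ => Finset.sum_congr rfl fun j _ => by ring

theorem outer_one_one : outer 1 1 = 1 := by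
  refine ext fun m n => ?_
  rw [outer_apply, one_apply_apply, ArithmeticFunction.one_apply, ArithmeticFunction.one_apply]
  split_ifs <;> simp_all

theorem outer_pow (a b : ArithmeticFunction ℂ) (k : ℕ) :
    outer a b ^ k = outer (a ^ k) (b ^ k) := by
  induction k with
  | zero => simp [outer_one_one]
  | succ k ih => rw [pow_succ, ih, outer_mul_outer, pow_succ, pow_succ]

theorem isMultiplicativeTwo_outer {a b : ArithmeticFunction ℂ} (ha : a.IsMultiplicative)
    (hb : b.IsMultiplicative) : (outer a b).IsMultiplicativeTwo := by
  intro m₁ m₂ n₁ n₂ hm₁ hm₂ hn₁ hn₂ h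
  have h : (m₁ * m₂).Coprime (n₁ * n₂) := h
  simp only [outer_apply]
  rw [ha.map_mul_of_coprime h.coprime_mul_right.coprime_mul_right_right,
    hb.map_mul_of_coprime h.coprime_mul_left.coprime_mul_left_right]
  ring

/-- The function supported on the diagonal with `(n, n) ↦ a(n)`. -/
def diag (a : ArithmeticFunction ℂ) : BiArith := ofFun fun m n => if m = n then a m else 0

theorem diag_apply (a : ArithmeticFunction ℂ) (m n : ℕ) :
    diag a m n = if m = n then a m else 0 := by
  change (if m = 0 ∨ n = 0 then 0 else if m = n then a m else 0) = _
  split_ifs with h h' <;> try rfl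
  subst h'
  simp_all

theorem diag_mul_apply (a : ArithmeticFunction ℂ) (f : BiArith) {m n : ℕ} (hm : m ≠ 0)
    (hn : n ≠ 0) :
    (diag a * f) m n = ∑ d ∈ (m.gcd n).divisors, a d * f (m / d) (n / d) := by
  rw [mul_apply_apply, Nat.sum_divisorsAntidiagonal fun i j =>
    ∑ b ∈ n.divisorsAntidiagonal, diag a i b.1 * f j b.2]
  have key : ∀ i ∈ m.divisors, (∑ b ∈ n.divisorsAntidiagonal, diag a i b.1 * f (m / i) b.2) =
      if i ∈ n.divisors then a i * f (m / i) (n / i) else 0 := by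
    intro i _
    rw [Nat.sum_divisorsAntidiagonal fun j l => diag a i j * f (m / i) l]
    simp only [diag_apply, ite_mul, zero_mul]
    rw [Finset.sum_ite_eq]
  rw [Finset.sum_congr rfl key, ← Finset.sum_filter]
  refine Finset.sum_congr ?_ fun _ _ => rfl
  ext d
  simp [Nat.dvd_gcd_iff, hm, hn]

theorem diag_mul_diag (a b : ArithmeticFunction ℂ) : diag a * diag b = diag (a * b) := by
  refine ext fun m n => ?_
  rcases eq_or_ne m 0 with rfl | hm
  · simp [apply_zero_left]
  rcases eq_or_ne n 0 with rfl | hn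
  · simp [apply_zero_right]
  rw [diag_mul_apply _ _ hm hn, diag_apply]
  split_ifs with h
  · subst h
    rw [ArithmeticFunction.mul_apply, Nat.gcd_self, Nat.sum_divisorsAntidiagonal fun i j => a i * b j]
    simp [diag_apply]
  · refine Finset.sum_eq_zero fun d hd => ?_
    have hd := Nat.dvd_of_mem_divisors hd
    rw [diag_apply, if_neg, mul_zero]
    intro h'
    exact h (by
      rw [← Nat.div_mul_cancel (hd.trans (Nat.gcd_dvd_left m n)), h',
        Nat.div_mul_cancel (hd.trans (Nat.gcd_dvd_right m n))])

theorem diag_one : diag 1 = 1 := by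
  refine ext fun m n => ?_
  rw [diag_apply, one_apply_apply, ArithmeticFunction.one_apply]
  split_ifs <;> first | rfl | omega

theorem isMultiplicativeTwo_diag {a : ArithmeticFunction ℂ} (ha : a.IsMultiplicative) :
    (diag a).IsMultiplicativeTwo := by
  intro m₁ m₂ n₁ n₂ hm₁ hm₂ hn₁ hn₂ h
  have h : (m₁ * m₂).Coprime (n₁ * n₂) := h
  simp only [diag_apply]
  have h₁₁ : m₁.Coprime n₁ := h.coprime_mul_right.coprime_mul_right_right
  have h₁₂ : m₁.Coprime n₂ := h.coprime_mul_right.coprime_mul_left_right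
  have h₂₁ : m₂.Coprime n₁ := h.coprime_mul_left.coprime_mul_right_right
  have h₂₂ : m₂.Coprime n₂ := h.coprime_mul_left.coprime_mul_left_right
  by_cases hm : m₁ = m₂
  · subst hm
    by_cases hn : n₁ = n₂
    · subst hn
      simp [ha.map_mul_of_coprime h₁₁]
    · simp [hn, hm₁.ne']
  · rw [if_neg, if_neg hm, zero_mul]
    -- As `m₁` is coprime to `n₂`, `m₁ n₁ = m₂ n₂` forces `m₁ ∣ m₂`; symmetrically `m₂ ∣ m₁`.
    intro e
    refine hm (Nat.dvd_antisymm ?_ ?_)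
    · exact h₁₂.dvd_of_dvd_mul_right (e ▸ dvd_mul_right _ _)
    · exact h₂₁.dvd_of_dvd_mul_right (e ▸ dvd_mul_right _ _)

/-- The identity function `n ↦ n` with complex values. -/
def idC : ArithmeticFunction ℂ := ((ArithmeticFunction.id : ArithmeticFunction ℕ) : ArithmeticFunction ℂ)

theorem idC_apply (n : ℕ) : idC n = n := by simp [idC]

theorem isMultiplicative_idC : idC.IsMultiplicative := isMultiplicative_id.natCast

/-- The Möbius function with complex values. -/
def moebiusC : ArithmeticFunction ℂ := ((moebius : ArithmeticFunction ℤ) : ArithmeticFunction ℂ)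

theorem isMultiplicative_moebiusC : moebiusC.IsMultiplicative := isMultiplicative_moebius.intCast

/-- The function with constant value `1` on positive integers, with complex values. -/
def zetaC : ArithmeticFunction ℂ := ((zeta : ArithmeticFunction ℕ) : ArithmeticFunction ℂ)

theorem isMultiplicative_zetaC : zetaC.IsMultiplicative := isMultiplicative_zeta.natCast

theorem zetaC_apply {n : ℕ} (hn : n ≠ 0) : zetaC n = 1 := by simp [zetaC, hn]

theorem zetaC_mul_moebiusC : zetaC * moebiusC = 1 := coe_zeta_mul_coe_moebius

theorem zetaC_mul_apply (a : ArithmeticFunction ℂ) (n : ℕ) :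
    (zetaC * a) n = ∑ d ∈ n.divisors, a d := coe_zeta_mul_apply

theorem ones_eq_outer : ones = outer zetaC zetaC := by
  refine ext fun m n => ?_
  rcases eq_or_ne m 0 with rfl | hm
  · simp [apply_zero_left]
  rcases eq_or_ne n 0 with rfl | hn
  · simp [apply_zero_right]
  rw [ones, ofFun_apply _ hm hn, outer_apply, zetaC_apply hm, zetaC_apply hn, one_mul]

/-- This is `gcd(m, n) = ∑ φ(d)` over common divisors `d`, with `φ = μ * id`. -/
theorem gcdFun_eq : gcdFun = diag (moebiusC * idC) * ones := by
  refine ext fun m n => ?_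
  rcases eq_or_ne m 0 with rfl | hm
  · simp [apply_zero_left]
  rcases eq_or_ne n 0 with rfl | hn
  · simp [apply_zero_right]
  rw [gcdFun, ofFun_apply _ hm hn, diag_mul_apply _ _ hm hn]
  have h : ∀ d ∈ (m.gcd n).divisors, (moebiusC * idC) d * ones (m / d) (n / d)
      = (moebiusC * idC) d := by
    intro d hd
    have hd := Nat.dvd_of_mem_divisors hd
    have h₁ : m / d ≠ 0 := (Nat.div_ne_zero_iff_of_dvd (hd.trans (Nat.gcd_dvd_left m n))).2
      ⟨hm, ne_zero_of_dvd_ne_zero hm (hd.trans (Nat.gcd_dvd_left m n))⟩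
    have h₂ : n / d ≠ 0 := (Nat.div_ne_zero_iff_of_dvd (hd.trans (Nat.gcd_dvd_right m n))).2
      ⟨hn, ne_zero_of_dvd_ne_zero hm (hd.trans (Nat.gcd_dvd_left m n))⟩
    rw [ones, ofFun_apply _ h₁ h₂, mul_one]
  rw [Finset.sum_congr rfl h, ← zetaC_mul_apply, ← mul_assoc, zetaC_mul_moebiusC, one_mul,
    idC_apply]

/-- Separates `diag μ`, whose double series converges absolutely, from `diag id * τ_k`, which
carries the growth. -/
theorem tauTilde_eq {k : ℕ} (hk : 1 ≤ k) :
    tauTilde k = diag moebiusC * (diag idC * tau k) := by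
  obtain ⟨k, rfl⟩ := Nat.exists_eq_add_of_le' hk
  rw [tauTilde, gcdFun_eq, ← diag_mul_diag, tau, Nat.add_sub_cancel, pow_succ]
  ring

/-- An inverse obtained from a unit reveals nothing about its values; the explicit form shows that
it is multiplicative. -/
theorem mu_eq (k : ℕ) : mu k = outer moebiusC moebiusC ^ k := by
  have h : tau k * outer moebiusC moebiusC ^ k = 1 := by
    rw [tau, ones_eq_outer, ← mul_pow, outer_mul_outer, zetaC_mul_moebiusC, outer_one_one, one_pow]
  calc mu k = mu k * (tau k * outer moebiusC moebiusC ^ k) := by rw [h, mul_one]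
    _ = _ := by rw [← mul_assoc, mu_mul_tau, one_mul]

theorem isMultiplicativeTwo_mu (k : ℕ) : (mu k).IsMultiplicativeTwo := by
  rw [mu_eq]
  exact (isMultiplicativeTwo_outer isMultiplicative_moebiusC isMultiplicative_moebiusC).pow k

/-- Since `n ↦ n` is completely multiplicative, twisting by it respects convolution, so `μ * 1 = δ`
becomes this identity. -/
theorem idC_mul_pmul_moebiusC : idC * (idC.pmul moebiusC) = 1 := by
  ext n
  rw [ArithmeticFunction.mul_apply]
  have h : ∀ x ∈ n.divisorsAntidiagonal, idC x.1 * (idC.pmul moebiusC) x.2 =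
      n * (zetaC x.1 * moebiusC x.2) := by
    intro x hx
    rw [pmul_apply, idC_apply, idC_apply,
      zetaC_apply (Nat.ne_zero_of_mem_divisorsAntidiagonal hx).1,
      ← (Nat.mem_divisorsAntidiagonal.1 hx).1]
    push_cast
    ring
  rw [Finset.sum_congr rfl h, ← Finset.mul_sum, ← ArithmeticFunction.mul_apply,
    zetaC_mul_moebiusC, ArithmeticFunction.one_apply]
  split_ifs with h <;> simp [h]

theorem muTilde_eq {k : ℕ} (hk : 1 ≤ k) :
    muTilde k = diag zetaC * (diag (idC.pmul moebiusC) * mu k) := by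
  have h : tauTilde k * (diag zetaC * (diag (idC.pmul moebiusC) * mu k)) = 1 := by
    rw [tauTilde_eq hk]
    calc _ = diag zetaC * diag moebiusC * (diag idC * diag (idC.pmul moebiusC)) *
          (mu k * tau k) := by ring
      _ = 1 := by
        rw [mu_mul_tau, diag_mul_diag, diag_mul_diag, zetaC_mul_moebiusC, idC_mul_pmul_moebiusC,
          diag_one, mul_one, mul_one]
  calc muTilde k = muTilde k * (tauTilde k * (diag zetaC * (diag (idC.pmul moebiusC) * mu k))) := by
        rw [h, mul_one]
    _ = _ := by rw [← mul_assoc, muTilde_mul_tauTilde, one_mul]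

theorem isMultiplicativeTwo_muTilde {k : ℕ} (hk : 1 ≤ k) : (muTilde k).IsMultiplicativeTwo := by
  rw [muTilde_eq hk]
  exact (isMultiplicativeTwo_diag isMultiplicative_zetaC).mul
    ((isMultiplicativeTwo_diag (isMultiplicative_idC.pmul isMultiplicative_moebiusC)).mul
      (isMultiplicativeTwo_mu k))

/-- The definition of multiplicativity admits the zero function, which the Euler product arguments
must treat apart. -/
theorem IsMultiplicativeTwo.apply_one_one_eq_one_or_eq_zero {f : BiArith}
    (hf : f.IsMultiplicativeTwo) : f 1 1 = 1 ∨ f = 0 := by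
  have h : ∀ m n : ℕ, 0 < m → 0 < n → f m n = f 1 1 * f m n := fun m n hm hn => by
    simpa using hf 1 1 m n one_pos one_pos hm hn (by simp)
  rcases eq_or_ne (f 1 1) 0 with h0 | h0
  · refine Or.inr (ext fun m n => ?_)
    rcases Nat.eq_zero_or_pos m with rfl | hm
    · simp [apply_zero_left]
    rcases Nat.eq_zero_or_pos n with rfl | hn
    · simp [apply_zero_right]
    rw [h m n hm hn, h0, zero_mul, zero_apply_apply]
  · exact Or.inl (mul_left_cancel₀ h0 (by rw [mul_one, ← h 1 1 one_pos one_pos]))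

end BiArith

/-! ### Euler products of double series. -/

namespace EulerProduct

/-- The inclusion of the primes into `ℕ`. -/
def primesEmb : Nat.Primes ↪ ℕ := ⟨fun p => (p : ℕ), Nat.Primes.coe_nat_injective⟩

/-- Positive integers all of whose prime factors are in `s`. -/
abbrev factored (s : Finset Nat.Primes) : Set ℕ :=
  Nat.factoredNumbers (s.map primesEmb)

/-- Any finite set of positive integers is eventually captured as the set of primes grows. -/
theorem exists_forall_mem_factored (u : Finset ℕ) :
    ∃ s₀ : Finset Nat.Primes, ∀ s, s₀ ⊆ s → ∀ m ∈ u, m ≠ 0 → m ∈ factored s := by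
  classical
  refine ⟨(u.biUnion Nat.primeFactors).subtype Nat.Prime, fun s hs m hm h0 => ⟨h0, fun p hp => ?_⟩⟩
  have hp' := Nat.prime_of_mem_primeFactorsList hp
  refine Finset.mem_map.2 ⟨⟨p, hp'⟩, hs (Finset.mem_subtype.2 ?_), rfl⟩
  exact Finset.mem_biUnion.2 ⟨m, hm, Nat.mem_primeFactors_iff_mem_primeFactorsList.2 hp⟩

variable {𝕜 : Type*} [NormedField 𝕜] [CompleteSpace 𝕜]

/-- The finite Euler product in two variables. -/
theorem summable_and_hasSum_factored_two {w : ℕ → ℕ → 𝕜} (h1 : w 1 1 = 1)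
    (hmul : ∀ m₁ m₂ n₁ n₂ : ℕ, 0 < m₁ → 0 < m₂ → 0 < n₁ → 0 < n₂ →
      Nat.gcd (m₁ * m₂) (n₁ * n₂) = 1 → w (m₁ * n₁) (m₂ * n₂) = w m₁ m₂ * w n₁ n₂)
    (hsum : ∀ p : Nat.Primes, Summable fun ν : ℕ × ℕ => ‖w (p ^ ν.1) (p ^ ν.2)‖)
    (s : Finset Nat.Primes) :
    Summable (fun q : factored s × factored s => ‖w q.1 q.2‖) ∧
      HasSum (fun q : factored s × factored s => w q.1 q.2)
        (∏ p ∈ s, ∑' ν : ℕ × ℕ, w (p ^ ν.1) (p ^ ν.2)) := by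
  induction s using Finset.induction with
  | empty =>
    have : Unique (factored ∅) := by
      rw [factored, Finset.map_empty, Nat.factoredNumbers_empty]; infer_instance
    have hd : ∀ x : factored ∅, (x : ℕ) = 1 := by
      rintro ⟨x, hx⟩
      rw [factored, Finset.map_empty, Nat.factoredNumbers_empty] at hx
      exact hx
    refine ⟨(hasSum_fintype _).summable, ?_⟩
    convert hasSum_fintype (fun q : factored ∅ × factored ∅ => w q.1 q.2)
    simp [hd, h1]
  | insert p s hp ih =>
    have hp' : (p : ℕ) ∉ s.map primesEmb := by
      intro h
      obtain ⟨q, hq, hqp⟩ := Finset.mem_map.1 h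
      exact hp (Nat.Primes.coe_nat_injective hqp ▸ hq)
    let e₁ := Nat.equivProdNatFactoredNumbers p.2 hp'
    have hset : factored (insert p s) =
        Nat.factoredNumbers (insert (p : ℕ) (s.map primesEmb)) := by
      rw [factored, Finset.map_insert]; rfl
    let e₂ : ℕ × factored s ≃ factored (insert p s) := e₁.trans (Equiv.setCongr hset.symm)
    have he₂ : ∀ x, ((e₂ x : factored (insert p s)) : ℕ) = (p : ℕ) ^ x.1 * x.2 := fun x => rfl
    -- Each pair factored over `insert p s` is uniquely `(p^i m, p^j n)` with `m`, `n` factored over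
    -- `s`; by multiplicativity the sum splits off the local series at `p`.
    obtain ⟨e, he⟩ : ∃ e : (ℕ × ℕ) × (factored s × factored s) ≃
        factored (insert p s) × factored (insert p s),
        ∀ x, w (e x).1 (e x).2 = w (p ^ x.1.1) (p ^ x.1.2) * w x.2.1 x.2.2 := by
      refine ⟨(Equiv.prodProdProdComm ℕ ℕ (factored s) (factored s)).trans (e₂.prodCongr e₂), ?_⟩
      rintro ⟨⟨i, j⟩, ⟨m, n⟩⟩
      change w (e₂ (i, m)) (e₂ (j, n)) = _
      rw [he₂, he₂]
      have hm : (p : ℕ).Coprime m := p.2.factoredNumbers_coprime hp' m.2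
      have hn : (p : ℕ).Coprime n := p.2.factoredNumbers_coprime hp' n.2
      refine hmul _ _ _ _ (pow_pos p.2.pos _) (pow_pos p.2.pos _) (Nat.pos_of_ne_zero m.2.1)
        (Nat.pos_of_ne_zero n.2.1) ?_
      rw [← pow_add]
      exact Nat.Coprime.pow_left _ (hm.mul_right hn)
    constructor
    · rw [← e.summable_iff]
      refine ((hsum p).mul_of_nonneg ih.1 (fun _ => norm_nonneg _) (fun _ => norm_nonneg _)).congr
        fun x => ?_
      rw [Function.comp_apply, he x, norm_mul]
    · rw [Finset.prod_insert hp, ← e.hasSum_iff]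
      simp only [Function.comp_def, he]
      have h₁ := (hsum p).of_norm.hasSum
      have h₂ := summable_mul_of_summable_norm
        (f := fun ν : ℕ × ℕ => w (p ^ ν.1) (p ^ ν.2))
        (g := fun q : factored s × factored s => w q.1 q.2) (hsum p) ih.1
      exact HasSum.mul (f := fun ν : ℕ × ℕ => w (p ^ ν.1) (p ^ ν.2))
        (g := fun q : factored s × factored s => w q.1 q.2) h₁ ih.2 h₂

/-- Indicators put all finite products on the fixed index set `ℕ × ℕ`, as comparison and dominated
convergence require. -/
theorem hasSum_indicator_factored_two {w : ℕ → ℕ → 𝕜} (h1 : w 1 1 = 1)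
    (hmul : ∀ m₁ m₂ n₁ n₂ : ℕ, 0 < m₁ → 0 < m₂ → 0 < n₁ → 0 < n₂ →
      Nat.gcd (m₁ * m₂) (n₁ * n₂) = 1 → w (m₁ * n₁) (m₂ * n₂) = w m₁ m₂ * w n₁ n₂)
    (hsum : ∀ p : Nat.Primes, Summable fun ν : ℕ × ℕ => ‖w (p ^ ν.1) (p ^ ν.2)‖)
    (s : Finset Nat.Primes) :
    HasSum ((factored s ×ˢ factored s).indicator fun q : ℕ × ℕ => w q.1 q.2)
        (∏ p ∈ s, ∑' ν : ℕ × ℕ, w (p ^ ν.1) (p ^ ν.2)) := by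
  rw [← hasSum_subtype_iff_indicator, ← (Equiv.Set.prod (factored s) (factored s)).symm.hasSum_iff]
  exact (summable_and_hasSum_factored_two h1 hmul hsum s).2

end EulerProduct

/-! ### Double series, local series and their behaviour under convolution. -/

namespace BiArith

open EulerProduct

/-- The terms `f(m, n) / (m n)` of the double series attached to `f`. -/
def wt (f : BiArith) (q : ℕ × ℕ) : ℂ := f q.1 q.2 / ((q.1 : ℂ) * q.2)

theorem wt_eq_zero (f : BiArith) {q : ℕ × ℕ} (h : q.1 = 0 ∨ q.2 = 0) : f.wt q = 0 := by
  rcases h with h | h <;> simp [wt, h]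

theorem localTerm_eq_wt (f : BiArith) (p : ℕ) (ν : ℕ × ℕ) :
    f.localTerm p ν = f.wt (p ^ ν.1, p ^ ν.2) := by
  simp [localTerm, wt, pow_add]

/-- Summability in `ℂ` is absolute, so the product of the two series may be regrouped along the
fibres of `((i, j), (k, l)) ↦ (ik, jl)`. -/
theorem hasSum_wt_mul {f g : BiArith} {a b : ℂ} (hf : HasSum f.wt a) (hg : HasSum g.wt b) :
    HasSum (f * g).wt (a * b) := by
  have h := (hf.mul hg (summable_mul_of_summable_norm hf.summable.norm
    hg.summable.norm)).tsum_fiberwise fun x => (x.1.1 * x.2.1, x.1.2 * x.2.2)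
  refine h.congr_fun fun q => ?_
  obtain ⟨m, n⟩ := q
  -- Fibres over pairs with a zero entry are infinite, but all their terms vanish.
  by_cases h0 : m = 0 ∨ n = 0
  · rw [wt_eq_zero _ h0]
    symm
    convert tsum_zero with x
    obtain ⟨⟨⟨i, j⟩, ⟨k, l⟩⟩, hx⟩ := x
    have hx : (i * k, j * l) = (m, n) := hx
    simp only [Prod.mk.injEq] at hx
    change f.wt (i, j) * g.wt (k, l) = 0
    rw [← hx.1, ← hx.2, mul_eq_zero, mul_eq_zero] at h0
    rcases h0 with (h0 | h0) | (h0 | h0)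
    · rw [wt_eq_zero f (Or.inl h0), zero_mul]
    · rw [wt_eq_zero g (Or.inl h0), mul_zero]
    · rw [wt_eq_zero f (Or.inr h0), zero_mul]
    · rw [wt_eq_zero g (Or.inr h0), mul_zero]
  · push Not at h0
    have hfib : (fun x : (ℕ × ℕ) × (ℕ × ℕ) => (x.1.1 * x.2.1, x.1.2 * x.2.2)) ⁻¹' {(m, n)} =
        ↑((m.divisorsAntidiagonal ×ˢ n.divisorsAntidiagonal).map
          (Equiv.prodProdProdComm ℕ ℕ ℕ ℕ).toEmbedding) := by
      ext ⟨⟨i, j⟩, ⟨k, l⟩⟩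
      simp [h0.1, h0.2]
    rw [hfib, Finset.tsum_subtype' _ fun x : (ℕ × ℕ) × (ℕ × ℕ) => f.wt x.1 * g.wt x.2,
      Finset.sum_map, Finset.sum_product, wt, mul_apply_apply, Finset.sum_div]
    refine Finset.sum_congr rfl fun x hx => ?_
    rw [Finset.sum_div]
    refine Finset.sum_congr rfl fun y hy => ?_
    rw [Nat.mem_divisorsAntidiagonal] at hx hy
    simp only [Equiv.coe_toEmbedding, Equiv.prodProdProdComm_apply, wt]
    rw [← hx.1, ← hy.1, div_mul_div_comm]
    push_cast
    congr 1
    ring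

/-- The restriction of `f` to powers of `p`. -/
def loc (p : ℕ) (f : BiArith) : BiArith :=
  open Classical in
  ofFun fun m n => if m ∈ Submonoid.powers p ∧ n ∈ Submonoid.powers p then f m n else 0

open Classical in
theorem loc_apply (p : ℕ) (f : BiArith) (m n : ℕ) :
    loc p f m n = if m ∈ Submonoid.powers p ∧ n ∈ Submonoid.powers p then f m n else 0 := by
  rcases eq_or_ne m 0 with rfl | hm
  · simp [apply_zero_left]
  rcases eq_or_ne n 0 with rfl | hn
  · simp [apply_zero_right]
  rw [loc, ofFun_apply _ hm hn]

/-- Divisors of powers of `p` are powers of `p`. A local series thus becomes a full double series,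
and `hasSum_wt_mul` yields the product rule at `p`. -/
theorem loc_mul {p : ℕ} (hp : p.Prime) (f g : BiArith) : loc p (f * g) = loc p f * loc p g := by
  classical
  have hdvd : ∀ {m d : ℕ}, m ∈ Submonoid.powers p → d ∣ m → d ∈ Submonoid.powers p := by
    rintro _ d ⟨i, rfl⟩ hd
    obtain ⟨j, _, rfl⟩ := (Nat.dvd_prime_pow hp).1 hd
    exact ⟨j, rfl⟩
  refine ext fun m n => ?_
  rw [loc_apply, mul_apply_apply, mul_apply_apply]
  split_ifs with h
  · refine Finset.sum_congr rfl fun a ha => Finset.sum_congr rfl fun b hb => ?_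
    rw [Nat.mem_divisorsAntidiagonal] at ha hb
    rw [loc_apply, loc_apply,
      if_pos ⟨hdvd h.1 (Dvd.intro _ ha.1), hdvd h.2 (Dvd.intro _ hb.1)⟩,
      if_pos ⟨hdvd h.1 (Dvd.intro_left _ ha.1), hdvd h.2 (Dvd.intro_left _ hb.1)⟩]
  · refine (Finset.sum_eq_zero fun a ha => Finset.sum_eq_zero fun b hb => ?_).symm
    rw [Nat.mem_divisorsAntidiagonal] at ha hb
    simp only [loc_apply]
    split_ifs with h₁ h₂ <;> try simp
    exact (h ⟨ha.1 ▸ mul_mem h₁.1 h₂.1, hb.1 ▸ mul_mem h₁.2 h₂.2⟩).elim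

theorem hasSum_localTerm_iff {p : ℕ} (hp : p.Prime) (f : BiArith) (a : ℂ) :
    HasSum (f.localTerm p) a ↔ HasSum (loc p f).wt a := by
  classical
  have hinj : Function.Injective fun ν : ℕ × ℕ => (p ^ ν.1, p ^ ν.2) := by
    rintro ⟨i, j⟩ ⟨k, l⟩ h
    simp only [Prod.mk.injEq] at h
    rw [Nat.pow_right_injective hp.two_le h.1, Nat.pow_right_injective hp.two_le h.2]
  rw [← hinj.hasSum_iff (f := (loc p f).wt)]
  · refine iff_of_eq (congrArg (HasSum · a) (funext fun ν => ?_))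
    rw [Function.comp_apply, localTerm_eq_wt, wt, wt, loc_apply, if_pos ⟨⟨_, rfl⟩, ⟨_, rfl⟩⟩]
  · rintro ⟨m, n⟩ h
    rw [wt, loc_apply, if_neg, zero_div]
    rintro ⟨⟨i, rfl⟩, ⟨j, rfl⟩⟩
    exact h ⟨(i, j), rfl⟩

theorem hasSum_localTerm_mul {p : ℕ} (hp : p.Prime) {f g : BiArith} {a b : ℂ}
    (hf : HasSum (f.localTerm p) a) (hg : HasSum (g.localTerm p) b) :
    HasSum ((f * g).localTerm p) (a * b) := by
  rw [hasSum_localTerm_iff hp] at *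
  rw [loc_mul hp]
  exact hasSum_wt_mul hf hg

theorem hasSum_localTerm_one {p : ℕ} (hp : p.Prime) : HasSum ((1 : BiArith).localTerm p) 1 := by
  convert hasSum_ite_eq ((0, 0) : ℕ × ℕ) (1 : ℂ) using 1
  ext ⟨i, j⟩
  simp only [localTerm, one_apply_apply, Nat.pow_eq_one, hp.ne_one, false_or, Prod.mk.injEq]
  split_ifs with h <;> simp [h]

theorem hasSum_localTerm_pow {p : ℕ} (hp : p.Prime) {f : BiArith} {a : ℂ}
    (hf : HasSum (f.localTerm p) a) (k : ℕ) : HasSum ((f ^ k).localTerm p) (a ^ k) := by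
  induction k with
  | zero => simpa using hasSum_localTerm_one hp
  | succ k ih => rw [pow_succ, pow_succ]; exact hasSum_localTerm_mul hp ih hf

theorem norm_one_div_prime_lt_one {p : ℕ} (hp : p.Prime) : ‖(1 / p : ℂ)‖ < 1 := by
  rw [norm_div, norm_one, Complex.norm_natCast, div_lt_one (by exact_mod_cast hp.pos)]
  exact_mod_cast hp.one_lt

theorem hasSum_localTerm_ones {p : ℕ} (hp : p.Prime) :
    HasSum (ones.localTerm p) ((1 - 1 / (p : ℂ))⁻¹ ^ 2) := by
  have h := hasSum_geometric_of_norm_lt_one (norm_one_div_prime_lt_one hp)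
  rw [pow_two]
  refine (h.mul h (summable_mul_of_summable_norm h.summable.norm h.summable.norm)).congr_fun
    fun ν => ?_
  rw [localTerm, ones, ofFun_apply _ (pow_ne_zero _ hp.ne_zero) (pow_ne_zero _ hp.ne_zero),
    ← pow_add, one_div_pow]

/-- Only `(p^i, p^i)` contributes, with term `p^i / p^(2i)`. This factor turns the exponent `2k` of
(i) into `2k + 1`. -/
theorem hasSum_localTerm_diag_idC {p : ℕ} (hp : p.Prime) :
    HasSum ((diag idC).localTerm p) (1 - 1 / (p : ℂ))⁻¹ := by
  have h := hasSum_geometric_of_norm_lt_one (norm_one_div_prime_lt_one hp)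
  have hinj : Function.Injective fun i : ℕ => (i, i) := fun i j h => (Prod.mk.inj h).1
  rw [← hinj.hasSum_iff]
  · refine h.congr_fun fun i => ?_
    have : (p : ℂ) ≠ 0 := by exact_mod_cast hp.ne_zero
    simp only [Function.comp_apply, localTerm, diag_apply, idC_apply, if_true, pow_add, one_div_pow]
    push_cast
    field_simp
  · rintro ⟨i, j⟩ hij
    rw [localTerm, diag_apply, if_neg, zero_div]
    intro h
    exact hij ⟨i, Prod.ext rfl (Nat.pow_right_injective hp.two_le h)⟩

theorem IsMultiplicativeTwo.wt_mul {g : BiArith} (hg : g.IsMultiplicativeTwo)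
    (m₁ m₂ n₁ n₂ : ℕ) (hm₁ : 0 < m₁) (hm₂ : 0 < m₂) (hn₁ : 0 < n₁) (hn₂ : 0 < n₂)
    (h : Nat.gcd (m₁ * m₂) (n₁ * n₂) = 1) :
    g.wt (m₁ * n₁, m₂ * n₂) = g.wt (m₁, m₂) * g.wt (n₁, n₂) := by
  simp only [wt]
  rw [hg m₁ m₂ n₁ n₂ hm₁ hm₂ hn₁ hn₂ h, div_mul_div_comm]
  push_cast
  congr 1
  ring

theorem PrimePowerSummable.hasSum_norm_localTerm {g : BiArith} (h1 : g 1 1 = 1)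
    (hs : g.PrimePowerSummable) (p : Nat.Primes) :
    HasSum (fun ν => ‖g.localTerm p ν‖)
      (1 + ∑' ν : {ν : ℕ × ℕ // 1 ≤ ν.1 + ν.2}, ‖g.localTerm p ν‖) := by
  have h : Summable fun ν : {ν : ℕ × ℕ // 1 ≤ ν.1 + ν.2} => ‖g.localTerm p ν‖ := by
    refine (hs.comp_injective (Prod.mk_right_injective p)).congr fun ν => ?_
    simp [localTerm]
  have h2 := (hasSum_subtype_iff_indicator (s := {ν : ℕ × ℕ | 1 ≤ ν.1 + ν.2})
    (f := fun ν => ‖g.localTerm p ν‖)).1 h.hasSum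
  refine ((hasSum_ite_eq ((0, 0) : ℕ × ℕ) (1 : ℝ)).add h2).congr_fun ?_
  rintro ⟨i, j⟩
  by_cases hij : (i, j) = ((0, 0) : ℕ × ℕ)
  · rw [if_pos hij, Set.indicator_of_notMem, hij]
    · simp [localTerm, h1]
    · simp_all
  · rw [if_neg hij, Set.indicator_of_mem, zero_add]
    simp only [Prod.mk.injEq] at hij
    change 1 ≤ i + j
    omega

/-- A finite set of pairs involves finitely many primes, so its sum of absolute values is at most a
finite Euler product `∏ (1 + e p)`, hence at most `exp (∑ e p)`. -/
theorem PrimePowerSummable.summable_wt {g : BiArith} (hg : g.IsMultiplicativeTwo)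
    (hs : g.PrimePowerSummable) : Summable g.wt := by
  rcases hg.apply_one_one_eq_one_or_eq_zero with h1 | rfl
  swap
  · refine summable_zero.congr fun q => ?_
    simp [wt, zero_apply_apply]
  have hloc := fun p => hs.hasSum_norm_localTerm h1 p
  set e : Nat.Primes → ℝ := fun p => ∑' ν : {ν : ℕ × ℕ // 1 ≤ ν.1 + ν.2}, ‖g.localTerm p ν‖
  have he0 : ∀ p, 0 ≤ e p := fun p => tsum_nonneg fun _ => norm_nonneg _
  have he : Summable e := by
    refine (Summable.prod hs).congr fun p => tsum_congr fun ν => ?_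
    simp [localTerm]
  have hprod := hasSum_indicator_factored_two (w := fun m n => ‖g.wt (m, n)‖) (by simp [wt, h1])
    (fun m₁ m₂ n₁ n₂ hm₁ hm₂ hn₁ hn₂ h => by
      rw [hg.wt_mul m₁ m₂ n₁ n₂ hm₁ hm₂ hn₁ hn₂ h, norm_mul])
    (fun p => by simpa only [norm_norm, ← localTerm_eq_wt] using (hloc p).summable)
  refine Summable.of_norm (summable_of_sum_le (c := Real.exp (∑' p, e p))
    (fun _ => norm_nonneg _) fun u => ?_)
  obtain ⟨s, hsu⟩ : ∃ s : Finset Nat.Primes, ∀ q ∈ u, q.1 ≠ 0 → q.2 ≠ 0 →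
      q ∈ factored s ×ˢ factored s := by
    obtain ⟨s, hs⟩ := exists_forall_mem_factored (u.image Prod.fst ∪ u.image Prod.snd)
    exact ⟨s, fun q hq h₁ h₂ =>
      ⟨hs s subset_rfl _ (Finset.mem_union_left _ (Finset.mem_image_of_mem _ hq)) h₁,
        hs s subset_rfl _ (Finset.mem_union_right _ (Finset.mem_image_of_mem _ hq)) h₂⟩⟩
  calc ∑ q ∈ u, ‖g.wt q‖
      ≤ ∑ q ∈ u, (factored s ×ˢ factored s).indicator (fun q : ℕ × ℕ => ‖g.wt (q.1, q.2)‖) q := by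
        refine Finset.sum_le_sum fun q hq => ?_
        by_cases h0 : q.1 = 0 ∨ q.2 = 0
        · rw [wt_eq_zero g h0, norm_zero]
          exact Set.indicator_nonneg (fun _ _ => norm_nonneg _) _
        · push Not at h0
          rw [Set.indicator_of_mem (hsu q hq h0.1 h0.2)]
    _ ≤ ∏ p ∈ s, ∑' ν : ℕ × ℕ, ‖g.wt (p ^ ν.1, p ^ ν.2)‖ :=
        sum_le_hasSum u (fun _ _ => Set.indicator_nonneg (fun _ _ => norm_nonneg _) _) (hprod s)
    _ = ∏ p ∈ s, (1 + e p) := Finset.prod_congr rfl fun p _ => by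
        simp only [← localTerm_eq_wt]
        exact (hloc p).tsum_eq
    _ ≤ Real.exp (∑ p ∈ s, e p) := Real.prod_one_add_le_exp_sum s he0
    _ ≤ Real.exp (∑' p, e p) := Real.exp_le_exp.2 (he.sum_le_tsum s fun p _ => he0 p)

theorem summable_localTerm {g : BiArith} (hs : Summable g.wt) {p : ℕ} (hp : p.Prime) :
    Summable (g.localTerm p) := by
  have hinj : Function.Injective fun ν : ℕ × ℕ => (p ^ ν.1, p ^ ν.2) := by
    rintro ⟨i, j⟩ ⟨k, l⟩ h
    simp only [Prod.mk.injEq] at h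
    rw [Nat.pow_right_injective hp.two_le h.1, Nat.pow_right_injective hp.two_le h.2]
  exact (hs.comp_injective hinj).congr fun ν => (localTerm_eq_wt g p ν).symm

/-- The Euler product of an absolutely convergent double series. -/
theorem IsMultiplicativeTwo.hasProd_tsum_localTerm {g : BiArith} (hg : g.IsMultiplicativeTwo)
    (hs : Summable g.wt) :
    HasProd (fun p : Nat.Primes => ∑' ν, g.localTerm p ν) (∑' q, g.wt q) := by
  rcases hg.apply_one_one_eq_one_or_eq_zero with h1 | rfl
  swap
  · have h : ∀ q, (0 : BiArith).wt q = 0 := fun q => by simp [wt, zero_apply_apply]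
    simp only [localTerm_eq_wt, h, tsum_zero]
    exact hasProd_zero_of_exists_eq_zero ⟨⟨2, Nat.prime_two⟩, rfl⟩
  have hprod := hasSum_indicator_factored_two (w := fun m n => g.wt (m, n)) (by simp [wt, h1])
    hg.wt_mul (fun p => by
      simpa only [← localTerm_eq_wt] using (summable_localTerm hs p.2).norm)
  have hfin : ∀ s : Finset Nat.Primes, ∏ p ∈ s, ∑' ν, g.localTerm p ν =
      ∑' q, (factored s ×ˢ factored s).indicator (fun q : ℕ × ℕ => g.wt (q.1, q.2)) q := fun s => by
    simp only [localTerm_eq_wt]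
    exact (hprod s).tsum_eq.symm
  -- Finite partial products are sums of `g.wt` cut off to factored pairs. They converge to the full
  -- sum by domination by `‖g.wt‖`, which gives unconditional convergence with limit `0` allowed.
  rw [HasProd, SummationFilter.unconditional_filter]
  simp only [hfin]
  refine tendsto_tsum_of_dominated_convergence hs.norm (fun q => ?_)
    (Eventually.of_forall fun s q => norm_indicator_le_norm_self _ _)
  refine tendsto_const_nhds.congr' ?_
  by_cases h0 : q.1 = 0 ∨ q.2 = 0
  · refine Eventually.of_forall fun s => ?_
    exact (wt_eq_zero g h0).trans (Set.indicator_apply_eq_zero.2 fun _ => wt_eq_zero g h0).symm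
  · push Not at h0
    obtain ⟨s₀, hs₀⟩ := exists_forall_mem_factored {q.1, q.2}
    filter_upwards [eventually_ge_atTop s₀] with s hs
    rw [Set.indicator_of_mem]
    exact ⟨hs₀ s hs _ (by simp) h0.1, hs₀ s hs _ (by simp) h0.2⟩

/-- The Euler factors of `f = g * u`, divided by those of `u`. -/
theorem hasProd_localTerm_of_eq_mul {f g u : BiArith} (hg : g.IsMultiplicativeTwo)
    (hs : Summable g.wt) (hf : f = g * u) {r : ℕ}
    (hu : ∀ p : ℕ, p.Prime → HasSum (u.localTerm p) ((1 - 1 / (p : ℂ))⁻¹ ^ r)) :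
    (∀ p : Nat.Primes, Summable (f.localTerm p)) ∧
      HasProd (fun p : Nat.Primes => (1 - 1 / ((p : ℕ) : ℂ)) ^ r * ∑' ν : ℕ × ℕ, f.localTerm p ν)
        (∑' q, g.wt q) := by
  have h : ∀ p : Nat.Primes, HasSum (f.localTerm p)
      ((∑' ν, g.localTerm p ν) * (1 - 1 / ((p : ℕ) : ℂ))⁻¹ ^ r) := fun p => by
    rw [hf]
    exact hasSum_localTerm_mul p.2 (summable_localTerm hs p.2).hasSum (hu p p.2)
  refine ⟨fun p => (h p).summable, ?_⟩
  convert hg.hasProd_tsum_localTerm hs using 2 with p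
  rw [(h p).tsum_eq]
  have h0 : (1 - 1 / ((p : ℕ) : ℂ)) ≠ 0 := by
    intro h0
    have := norm_one_div_prime_lt_one p.2
    rw [← sub_eq_zero.1 h0, norm_one] at this
    exact lt_irrefl _ this
  rw [mul_comm, mul_assoc, ← mul_pow, inv_mul_cancel₀ h0, one_pow, mul_one]

end BiArith

/-! ### Asymptotics of logarithmic sums and divisor sums. -/

theorem pow_succ_sub_pow_succ_le {a b : ℝ} (hb : 0 ≤ b) (hab : b ≤ a) (m : ℕ) :
    a ^ (m + 1) - b ^ (m + 1) ≤ (m + 1) * a ^ m * (a - b) := by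
  induction m with
  | zero => simp
  | succ m ih =>
    have h1 := mul_le_mul_of_nonneg_left ih (hb.trans hab)
    have h2 := mul_le_mul_of_nonneg_right (pow_le_pow_left₀ hb hab (m + 1)) (sub_nonneg.2 hab)
    calc a ^ (m + 1 + 1) - b ^ (m + 1 + 1)
        = a * (a ^ (m + 1) - b ^ (m + 1)) + b ^ (m + 1) * (a - b) := by ring
      _ ≤ a * ((m + 1) * a ^ m * (a - b)) + a ^ (m + 1) * (a - b) := add_le_add h1 h2
      _ = _ := by push_cast; ring

theorem le_pow_succ_sub_pow_succ {a b : ℝ} (hb : 0 ≤ b) (hab : b ≤ a) (m : ℕ) :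
    (m + 1) * b ^ m * (a - b) ≤ a ^ (m + 1) - b ^ (m + 1) := by
  induction m with
  | zero => simp
  | succ m ih =>
    have h1 := mul_le_mul_of_nonneg_left ih hb
    have h2 := mul_le_mul_of_nonneg_right (pow_le_pow_left₀ hb hab (m + 1)) (sub_nonneg.2 hab)
    calc (((m + 1 : ℕ) : ℝ) + 1) * b ^ (m + 1) * (a - b)
        = b * ((m + 1) * b ^ m * (a - b)) + b ^ (m + 1) * (a - b) := by push_cast; ring
      _ ≤ b * (a ^ (m + 1) - b ^ (m + 1)) + a ^ (m + 1) * (a - b) := add_le_add h1 h2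
      _ = _ := by ring

/-- The sum `∑_{d ≤ x} log(x/d)^m / d`. -/
def logSum (m : ℕ) (x : ℝ) : ℝ := ∑ d ∈ Finset.Icc 1 ⌊x⌋₊, Real.log (x / d) ^ m / d

theorem one_le_div_of_mem_Icc {x : ℝ} {d : ℕ} (hd : d ∈ Finset.Icc 1 ⌊x⌋₊) : 1 ≤ x / d := by
  rw [Finset.mem_Icc] at hd
  rw [one_le_div (by exact_mod_cast hd.1)]
  exact (Nat.le_floor_iff' (by omega)).1 hd.2

theorem logSum_eq_sum_range (m : ℕ) (x : ℝ) :
    logSum m x = ∑ i ∈ Finset.range ⌊x⌋₊, Real.log (x / (i + 1 : ℕ)) ^ m / (i + 1 : ℕ) := by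
  rw [logSum, Finset.range_eq_Ico,
    Finset.sum_Ico_add' (fun d : ℕ => Real.log (x / d) ^ m / d) 0 ⌊x⌋₊ 1]
  rfl

theorem log_div_sub_log_div {x : ℝ} (hx : 0 < x) (i : ℕ) :
    Real.log (x / (i + 1 : ℕ)) - Real.log (x / (i + 2 : ℕ)) = Real.log (1 + 1 / (i + 1 : ℝ)) := by
  have h1 : (0 : ℝ) < i + 1 := by positivity
  have h2 : (0 : ℝ) < i + 2 := by positivity
  push_cast
  rw [← Real.log_div (by positivity) (by positivity)]
  congr 1
  field_simp
  ring

/-- With `v i = log(x/(i+1))`, the gap `v i - v (i+1) = log(1 + 1/(i+1))` is at most `1/(i+1)`, so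
the sum dominates a telescoping sum of differences of `v^(m+1)`. -/
theorem le_logSum (m : ℕ) {x : ℝ} (hx : 1 ≤ x) :
    Real.log x ^ (m + 1) / (m + 1) ≤ logSum m x := by
  have hx0 : 0 < x := by linarith
  -- Truncation at `0` makes the endpoint `v ⌊x⌋₊` vanish, where the logarithm is negative.
  set v : ℕ → ℝ := fun i => max (Real.log (x / (i + 1 : ℕ))) 0 with hv
  have hv0 : v 0 = Real.log x := by simp [hv, Real.log_nonneg hx]
  have hvN : v ⌊x⌋₊ = 0 := by
    refine max_eq_right (Real.log_nonpos (by positivity) ?_)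
    rw [div_le_one (by positivity)]
    push_cast
    exact (Nat.lt_floor_add_one x).le
  have hpos : ∀ i, 0 ≤ v i := fun i => le_max_right _ _
  have hstep : ∀ i, v i - v (i + 1) ≤ 1 / (i + 1 : ℝ) := fun i => by
    have h := log_div_sub_log_div hx0 i
    have h' := Real.log_le_sub_one_of_pos (show (0 : ℝ) < 1 + 1 / (i + 1) by positivity)
    have h0 : (0 : ℝ) ≤ 1 / (i + 1) := by positivity
    rw [sub_le_iff_le_add]
    refine max_le ?_ (add_nonneg h0 (hpos _))
    have := le_max_left (Real.log (x / (i + 1 + 1 : ℕ))) 0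
    change Real.log (x / (i + 2 : ℕ)) ≤ v (i + 1) at this
    linarith
  have hanti : ∀ i, v (i + 1) ≤ v i := fun i => by
    refine max_le_max (Real.log_le_log (by positivity) ?_) le_rfl
    gcongr
    omega
  rw [div_le_iff₀ (by positivity), logSum_eq_sum_range]
  have htel : ∑ i ∈ Finset.range ⌊x⌋₊, (v i ^ (m + 1) - v (i + 1) ^ (m + 1)) =
      Real.log x ^ (m + 1) := by
    rw [Finset.sum_range_sub' (fun i => v i ^ (m + 1)), hv0, hvN]
    simp
  rw [← htel, Finset.sum_mul]
  refine Finset.sum_le_sum fun i hi => ?_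
  have hvi : v i = Real.log (x / (i + 1 : ℕ)) := by
    refine max_eq_left (Real.log_nonneg (one_le_div_of_mem_Icc (Finset.mem_Icc.2 ⟨by omega, ?_⟩)))
    exact Finset.mem_range.1 hi
  calc v i ^ (m + 1) - v (i + 1) ^ (m + 1) ≤ (m + 1) * v i ^ m * (v i - v (i + 1)) :=
        pow_succ_sub_pow_succ_le (hpos _) (hanti i) m
    _ ≤ (m + 1) * v i ^ m * (1 / (i + 1 : ℝ)) :=
        mul_le_mul_of_nonneg_left (hstep i) (mul_nonneg (by positivity) (pow_nonneg (hpos i) m))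
    _ = _ := by rw [← hvi]; push_cast; ring

/-- The same gap is at least `1/(i+2)`, so the terms with `d ≥ 2` are bounded by the telescoping
sum; `d = 1` accounts for the extra `log x ^ m`. -/
theorem logSum_le (m : ℕ) {x : ℝ} (hx : 1 ≤ x) :
    logSum m x ≤ Real.log x ^ (m + 1) / (m + 1) + Real.log x ^ m := by
  have hx0 : 0 < x := by linarith
  obtain ⟨N, hN⟩ : ∃ N, ⌊x⌋₊ = N + 1 :=
    Nat.exists_eq_add_of_le' (Nat.le_floor (by simpa using hx))
  rw [logSum_eq_sum_range, hN, Finset.sum_range_succ']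
  have hlast : Real.log (x / ((0 + 1 : ℕ) : ℝ)) ^ m / ((0 + 1 : ℕ) : ℝ) = Real.log x ^ m := by simp
  rw [hlast]
  refine add_le_add ?_ le_rfl
  rw [le_div_iff₀ (by positivity)]
  set v : ℕ → ℝ := fun i => Real.log (x / (i + 1 : ℕ)) with hv
  have hpos : ∀ i, i ≤ N → 0 ≤ v i := fun i hi =>
    Real.log_nonneg (one_le_div_of_mem_Icc (Finset.mem_Icc.2 ⟨by omega, by omega⟩))
  have hanti : ∀ i, v (i + 1) ≤ v i := fun i => by
    refine Real.log_le_log (by positivity) ?_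
    gcongr
    omega
  have hstep : ∀ i : ℕ, 1 / (i + 2 : ℝ) ≤ v i - v (i + 1) := fun i => by
    have h := log_div_sub_log_div hx0 i
    have h' := Real.one_sub_inv_le_log_of_pos (show (0 : ℝ) < 1 + 1 / (i + 1) by positivity)
    have h1 : (0 : ℝ) < i + 1 := by positivity
    have h2 : (0 : ℝ) < i + 2 := by positivity
    have h3 : 1 - (1 + 1 / (i + 1 : ℝ))⁻¹ = 1 / (i + 2) := by
      have : (1 + 1 / (i + 1 : ℝ)) = (i + 2) / (i + 1) := by field_simp; ring
      rw [this]
      field_simp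
      ring
    rw [h3] at h'
    exact h'.trans h.ge
  have htel : ∑ i ∈ Finset.range N, (v i ^ (m + 1) - v (i + 1) ^ (m + 1)) ≤
      Real.log x ^ (m + 1) := by
    rw [Finset.sum_range_sub' (fun i => v i ^ (m + 1))]
    have : v 0 = Real.log x := by simp [hv]
    rw [this]
    exact sub_le_self _ (pow_nonneg (hpos N le_rfl) _)
  refine le_trans ?_ htel
  rw [Finset.sum_mul]
  refine Finset.sum_le_sum fun i hi => ?_
  have hi' := hpos (i + 1) (Finset.mem_range.1 hi)
  calc v (i + 1) ^ m / ((i + 1 + 1 : ℕ) : ℝ) * (m + 1)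
      = (m + 1) * v (i + 1) ^ m * (1 / (i + 2 : ℝ)) := by push_cast; ring
    _ ≤ (m + 1) * v (i + 1) ^ m * (v i - v (i + 1)) :=
        mul_le_mul_of_nonneg_left (hstep i) (mul_nonneg (by positivity) (pow_nonneg hi' m))
    _ ≤ _ := le_pow_succ_sub_pow_succ hi' (hanti i) m

theorem tendsto_logSum (m : ℕ) :
    Tendsto (fun x => logSum m x / Real.log x ^ (m + 1)) atTop (𝓝 (1 / (m + 1))) := by
  have hlog : ∀ᶠ x : ℝ in atTop, 1 ≤ x ∧ 0 < Real.log x := by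
    filter_upwards [eventually_ge_atTop 1, Real.tendsto_log_atTop.eventually_gt_atTop 0] with x h h'
    exact ⟨h, h'⟩
  have hup : Tendsto (fun x : ℝ => 1 / ((m : ℝ) + 1) + (Real.log x)⁻¹) atTop
      (𝓝 (1 / (m + 1) + 0)) :=
    tendsto_const_nhds.add Real.tendsto_log_atTop.inv_tendsto_atTop
  rw [add_zero] at hup
  refine tendsto_of_tendsto_of_tendsto_of_le_of_le' tendsto_const_nhds hup ?_ ?_
  · filter_upwards [hlog] with x ⟨hx, hl⟩
    rw [le_div_iff₀ (pow_pos hl _)]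
    calc _ = Real.log x ^ (m + 1) / (m + 1) := by ring
      _ ≤ _ := le_logSum m hx
  · filter_upwards [hlog] with x ⟨hx, hl⟩
    rw [div_le_iff₀ (pow_pos hl _)]
    calc _ ≤ _ := logSum_le m hx
      _ = _ := by field_simp; ring

/-- If `F(u) ~ c u (log u)^m`, then `∑_{d ≤ x} F(x/d) ~ c x (log x)^(m+1) / (m+1)`. -/
theorem tendsto_sum_apply_div {F : ℝ → ℝ} {c : ℝ} (m : ℕ)
    (hF : Tendsto (fun u => F u / (u * Real.log u ^ m)) atTop (𝓝 c))
    (hb : ∀ U : ℝ, ∃ K, ∀ u, 1 ≤ u → u ≤ U → |F u| ≤ K) :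
    Tendsto (fun x : ℝ => (∑ d ∈ Finset.Icc 1 ⌊x⌋₊, F (x / d)) / (x * Real.log x ^ (m + 1))) atTop
      (𝓝 (c / (m + 1))) := by
  have hmain : Tendsto (fun x => c * (logSum m x / Real.log x ^ (m + 1))) atTop
      (𝓝 (c / (m + 1))) := by
    simpa [div_eq_mul_inv] using (tendsto_logSum m).const_mul c
  -- The asymptotic error holds beyond some `U`, and `hb` covers `[1, U]` at the cost of a constant
  -- `K`. Summed over `d ≤ x`, this costs only `K x = o(x (log x)^(m+1))`.
  have happrox : ∀ ε > 0, ∃ K, 0 ≤ K ∧ ∀ u, 1 ≤ u →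
      |F u - c * (u * Real.log u ^ m)| ≤ ε * (u * Real.log u ^ m) + K := by
    intro ε hε
    obtain ⟨U, hU⟩ := eventually_atTop.1 ((Metric.tendsto_nhds.1 hF ε hε).and
      (eventually_gt_atTop (1 : ℝ)))
    obtain ⟨K, hK⟩ := hb U
    refine ⟨|K| + |c| * (|U| * |Real.log U| ^ m), by positivity, fun u hu => ?_⟩
    have hlu := Real.log_nonneg hu
    have hε' : 0 ≤ ε * (u * Real.log u ^ m) := by positivity
    rcases le_total U u with h | h
    · obtain ⟨h1, h2⟩ := hU u h
      have hl := Real.log_pos h2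
      have hpos : 0 < u * Real.log u ^ m := by positivity
      rw [Real.dist_eq, ← mul_lt_mul_iff_left₀ hpos, ← abs_of_pos hpos, ← abs_mul, sub_mul,
        abs_of_pos hpos, div_mul_cancel₀ _ hpos.ne'] at h1
      exact h1.le.trans (le_add_of_nonneg_right (by positivity))
    · refine le_trans ?_ (le_add_of_nonneg_left hε')
      refine (abs_sub _ _).trans (add_le_add ((hK u hu h).trans (le_abs_self K)) ?_)
      rw [abs_mul]
      refine mul_le_mul_of_nonneg_left ?_ (abs_nonneg c)
      rw [abs_of_nonneg (by positivity)]
      exact mul_le_mul (h.trans (le_abs_self U)) (pow_le_pow_left₀ hlu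
        ((Real.log_le_log (by linarith) h).trans (le_abs_self _)) m) (by positivity) (abs_nonneg U)
  have hdiff : Tendsto (fun x : ℝ => (∑ d ∈ Finset.Icc 1 ⌊x⌋₊, F (x / d)) /
      (x * Real.log x ^ (m + 1)) - c * (logSum m x / Real.log x ^ (m + 1))) atTop (𝓝 0) := by
    rw [Metric.tendsto_nhds]
    intro ε hε
    -- The ratio of `logSum` tends to `1/(m+1) ≤ 1`, hence is eventually below `2`: the two errors
    -- are at most `ε/4 * 2` and less than `ε/2`.
    obtain ⟨K, hK0, hK⟩ := happrox (ε / 4) (by positivity)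
    have h1 : ∀ᶠ x in atTop, logSum m x / Real.log x ^ (m + 1) < 2 := by
      refine (tendsto_logSum m).eventually_lt_const ?_
      rw [div_lt_iff₀ (by positivity)]
      have : (0 : ℝ) ≤ m := by positivity
      linarith
    have h2 : ∀ᶠ x in atTop, K / Real.log x ^ (m + 1) < ε / 2 := by
      refine Tendsto.eventually_lt_const (by positivity) (Tendsto.div_atTop tendsto_const_nhds
        ((tendsto_pow_atTop (Nat.succ_ne_zero m)).comp Real.tendsto_log_atTop))
    filter_upwards [h1, h2, eventually_ge_atTop 1, Real.tendsto_log_atTop.eventually_gt_atTop 0]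
      with x h1 h2 hx hl
    have hx0 : 0 < x := by linarith
    have hS : logSum m x = (∑ d ∈ Finset.Icc 1 ⌊x⌋₊, x / d * Real.log (x / d) ^ m) / x := by
      rw [logSum, Finset.sum_div]
      refine Finset.sum_congr rfl fun d _ => ?_
      field_simp
    have hxS : ∑ d ∈ Finset.Icc 1 ⌊x⌋₊, x / d * Real.log (x / d) ^ m = x * logSum m x := by
      rw [hS]; field_simp
    have hbound : |∑ d ∈ Finset.Icc 1 ⌊x⌋₊, F (x / d) - c * (x * logSum m x)| ≤
        ε / 4 * (x * logSum m x) + K * x := by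
      rw [← hxS, Finset.mul_sum, ← Finset.sum_sub_distrib]
      refine (Finset.abs_sum_le_sum_abs _ _).trans
        ((Finset.sum_le_sum fun (d : ℕ) hd => hK (x / d) (one_le_div_of_mem_Icc hd)).trans ?_)
      rw [Finset.sum_add_distrib, ← Finset.mul_sum]
      refine add_le_add le_rfl ?_
      rw [Finset.sum_const, Nat.card_Icc, Nat.add_sub_cancel, nsmul_eq_mul, mul_comm]
      exact mul_le_mul_of_nonneg_left (Nat.floor_le hx0.le) hK0
    have hL : 0 < x * Real.log x ^ (m + 1) := by positivity
    have heq : (∑ d ∈ Finset.Icc 1 ⌊x⌋₊, F (x / d)) / (x * Real.log x ^ (m + 1)) -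
        c * (logSum m x / Real.log x ^ (m + 1)) =
        (∑ d ∈ Finset.Icc 1 ⌊x⌋₊, F (x / d) - c * (x * logSum m x)) /
          (x * Real.log x ^ (m + 1)) := by
      field_simp
    rw [dist_zero_right, Real.norm_eq_abs, heq, abs_div, abs_of_pos hL]
    calc _ ≤ (ε / 4 * (x * logSum m x) + K * x) / (x * Real.log x ^ (m + 1)) := by gcongr
      _ = ε / 4 * (logSum m x / Real.log x ^ (m + 1)) + K / Real.log x ^ (m + 1) := by
        field_simp
      _ < ε / 4 * 2 + ε / 2 := by gcongr
      _ = ε := by ring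
  simpa using hdiff.add hmain

namespace Nat

theorem sum_sum_divisorsAntidiagonal {M : Type*} [AddCommMonoid M] (N : ℕ) (F : ℕ → ℕ → M) :
    ∑ n ∈ Finset.Icc 1 N, ∑ p ∈ n.divisorsAntidiagonal, F p.1 p.2 =
      ∑ a ∈ Finset.Icc 1 N, ∑ b ∈ Finset.Icc 1 (N / a), F a b := by
  rw [Finset.sum_sigma', Finset.sum_sigma']
  refine Finset.sum_bij' (fun x _ => ⟨x.2.1, x.2.2⟩) (fun x _ => ⟨x.1 * x.2, (x.1, x.2)⟩)
    ?_ ?_ ?_ ?_ ?_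
  · rintro ⟨n, a, b⟩ h
    simp only [Finset.mem_sigma, Finset.mem_Icc, mem_divisorsAntidiagonal] at h ⊢
    obtain ⟨⟨hn, hN⟩, rfl, h0⟩ := h
    have ha : 0 < a := Nat.pos_of_ne_zero (left_ne_zero_of_mul h0)
    have hb : 0 < b := Nat.pos_of_ne_zero (right_ne_zero_of_mul h0)
    exact ⟨⟨ha, (Nat.le_mul_of_pos_right a hb).trans hN⟩, hb,
      (Nat.le_div_iff_mul_le ha).2 (by rwa [mul_comm])⟩
  · rintro ⟨a, b⟩ h
    simp only [Finset.mem_sigma, Finset.mem_Icc, mem_divisorsAntidiagonal] at h ⊢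
    have := (Nat.le_div_iff_mul_le h.1.1).1 h.2.2
    have h0 : 0 < a * b := Nat.mul_pos h.1.1 h.2.1
    exact ⟨⟨h0, by rwa [mul_comm]⟩, trivial, h0.ne'⟩
  · rintro ⟨n, a, b⟩ h
    simp only [Finset.mem_sigma, mem_divisorsAntidiagonal] at h
    obtain ⟨-, rfl, -⟩ := h
    rfl
  · rintro ⟨a, b⟩ _
    rfl
  · rintro ⟨n, a, b⟩ _
    rfl

end Nat

open ArithmeticFunction in
/-- The summatory function `∑_{n ≤ x} τ_k(n)` of the `k`-fold divisor function. -/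
def divisorSum (k : ℕ) (x : ℝ) : ℝ :=
  ∑ n ∈ Finset.Icc 1 ⌊x⌋₊, (((zeta : ArithmeticFunction ℕ) ^ k) n : ℝ)

theorem divisorSum_nonneg (k : ℕ) (x : ℝ) : 0 ≤ divisorSum k x :=
  Finset.sum_nonneg fun _ _ => Nat.cast_nonneg _

theorem divisorSum_mono (k : ℕ) : Monotone (divisorSum k) := fun _ _ h =>
  Finset.sum_le_sum_of_subset_of_nonneg (Finset.Icc_subset_Icc le_rfl (Nat.floor_mono h))
    fun _ _ _ => Nat.cast_nonneg _

theorem divisorSum_of_lt_one (k : ℕ) {x : ℝ} (hx : x < 1) : divisorSum k x = 0 := by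
  simp [divisorSum, Nat.floor_eq_zero.2 hx]

theorem divisorSum_one (x : ℝ) : divisorSum 1 x = ⌊x⌋₊ := by
  rw [divisorSum, pow_one, Finset.sum_congr rfl (g := fun _ => (1 : ℝ))]
  · simp
  · intro n hn
    rw [ArithmeticFunction.zeta_apply_ne (by have := Finset.mem_Icc.1 hn; omega), Nat.cast_one]

theorem divisorSum_succ (k : ℕ) (x : ℝ) :
    divisorSum (k + 1) x = ∑ d ∈ Finset.Icc 1 ⌊x⌋₊, divisorSum k (x / d) := by
  simp only [divisorSum, pow_succ', ArithmeticFunction.mul_apply, Nat.cast_sum, Nat.cast_mul]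
  rw [Nat.sum_sum_divisorsAntidiagonal ⌊x⌋₊ fun a b =>
    ((ArithmeticFunction.zeta a : ℕ) : ℝ) * ((ArithmeticFunction.zeta ^ k) b : ℕ)]
  refine Finset.sum_congr rfl fun d hd => ?_
  rw [Nat.floor_div_natCast]
  refine Finset.sum_congr rfl fun n _ => ?_
  rw [ArithmeticFunction.zeta_apply_ne (by have := Finset.mem_Icc.1 hd; omega), Nat.cast_one,
    one_mul]

/-- A bound valid for every `x ≥ 1`, not only asymptotically, as dominated convergence needs. Each
induction step costs one harmonic sum. -/
theorem divisorSum_succ_le (k : ℕ) {x : ℝ} (hx : 1 ≤ x) :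
    divisorSum (k + 1) x ≤ x * (1 + Real.log x) ^ k := by
  induction k generalizing x with
  | zero =>
    rw [zero_add, divisorSum_one, pow_zero, mul_one]
    exact Nat.floor_le (by linarith)
  | succ k ih =>
    have hl := Real.log_nonneg hx
    have hx0 : 0 < x := by linarith
    rw [divisorSum_succ]
    calc ∑ d ∈ Finset.Icc 1 ⌊x⌋₊, divisorSum (k + 1) (x / d)
        -- The zeroth power of the logarithm puts the harmonic sum in the form `logSum 0 x`.
        ≤ ∑ d ∈ Finset.Icc 1 ⌊x⌋₊, x * (1 + Real.log x) ^ k * (Real.log (x / d) ^ 0 / d) := by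
          refine Finset.sum_le_sum fun d hd => (ih (one_le_div_of_mem_Icc hd)).trans ?_
          have hd1 : (1 : ℝ) ≤ d := by exact_mod_cast (Finset.mem_Icc.1 hd).1
          have hlog : Real.log (x / d) ≤ Real.log x :=
            Real.log_le_log (by positivity) (div_le_self hx0.le hd1)
          have hlog0 := Real.log_nonneg (one_le_div_of_mem_Icc hd)
          calc x / d * (1 + Real.log (x / d)) ^ k ≤ x / d * (1 + Real.log x) ^ k := by gcongr
            _ = _ := by rw [pow_zero]; ring
      _ = x * (1 + Real.log x) ^ k * logSum 0 x := by rw [← Finset.mul_sum]; rfl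
      _ ≤ x * (1 + Real.log x) ^ k * (1 + Real.log x) := by
          have := logSum_le 0 hx
          gcongr
          simpa [add_comm] using this
      _ = _ := by ring

theorem tendsto_divisorSum (k : ℕ) :
    Tendsto (fun x => divisorSum (k + 1) x / (x * Real.log x ^ k)) atTop
      (𝓝 (1 / (k.factorial : ℝ))) := by
  induction k with
  | zero => simpa [divisorSum_one] using tendsto_nat_floor_div_atTop (R := ℝ)
  | succ k ih =>
    have h := tendsto_sum_apply_div k ih fun U => ⟨divisorSum (k + 1) U, fun u _ hu => by
      rw [abs_of_nonneg (divisorSum_nonneg _ _)]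
      exact divisorSum_mono _ hu⟩
    simp only [← divisorSum_succ] at h
    convert h using 2
    rw [Nat.factorial_succ]
    push_cast
    field_simp

theorem tendsto_log_div_div_log {a : ℝ} (ha : 0 < a) :
    Tendsto (fun x => Real.log (x / a) / Real.log x) atTop (𝓝 1) := by
  have h : Tendsto (fun x => 1 - Real.log a / Real.log x) atTop (𝓝 (1 - 0)) :=
    tendsto_const_nhds.sub (Tendsto.div_atTop tendsto_const_nhds Real.tendsto_log_atTop)
  rw [sub_zero] at h
  refine h.congr' ?_
  filter_upwards [eventually_gt_atTop 0, Real.tendsto_log_atTop.eventually_gt_atTop 0] with x hx hl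
  rw [Real.log_div hx.ne' ha.ne', sub_div, div_self hl.ne']

theorem tendsto_divisorSum_div (k : ℕ) {a : ℝ} (ha : 0 < a) :
    Tendsto (fun x => divisorSum (k + 1) (x / a) / (x * Real.log x ^ k)) atTop
      (𝓝 (1 / (k.factorial : ℝ) / a)) := by
  have h1 := (tendsto_divisorSum k).comp (tendsto_id.atTop_div_const ha)
  have h2 := ((h1.mul ((tendsto_log_div_div_log ha).pow k)).div_const a)
  rw [one_pow, mul_one] at h2
  refine h2.congr' ?_
  filter_upwards [eventually_gt_atTop 0, Real.tendsto_log_atTop.eventually_gt_atTop 0,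
    (Real.tendsto_log_atTop.comp (tendsto_id.atTop_div_const ha)).eventually_gt_atTop 0]
    with x hx hl hl'
  simp only [Function.comp_apply, id] at hl' ⊢
  rw [div_pow]
  field_simp

/-- The sum `∑_{d ≤ x} d T(x/(ad)) T(x/(bd))`, where `T` is the summatory function of `τ_k`. -/
theorem tendsto_sum_mul_divisorSum (k : ℕ) {a b : ℝ} (ha : 0 < a) (hb : 0 < b) :
    Tendsto (fun x : ℝ => (∑ d ∈ Finset.Icc 1 ⌊x⌋₊,
        d * (divisorSum (k + 1) (x / a / d) * divisorSum (k + 1) (x / b / d))) /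
        (x ^ 2 * Real.log x ^ (2 * k + 1))) atTop
      (𝓝 (1 / ((k.factorial : ℝ) ^ 2 * (2 * k + 1)) / (a * b))) := by
  -- The summand equals `x F(x/d)` with `F(u) = T(u/a) T(u/b) / u`, and `F(u) ~ c u (log u)^(2k)`.
  -- The sum over `d` supplies the factor `1/(2k+1)`.
  have h := tendsto_sum_apply_div (2 * k)
    (F := fun u => divisorSum (k + 1) (u / a) * divisorSum (k + 1) (u / b) / u)
    (c := 1 / (k.factorial : ℝ) / a * (1 / (k.factorial : ℝ) / b)) ?_ ?_
  · convert h.congr' ?_ using 2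
    · push_cast
      field_simp
    · filter_upwards [eventually_gt_atTop 0] with x hx
      rw [pow_two, mul_assoc, ← div_div _ x (x * _)]
      congr 1
      rw [Finset.sum_div]
      refine Finset.sum_congr rfl fun d hd => ?_
      have hd0 : (0 : ℝ) < d := by exact_mod_cast (Finset.mem_Icc.1 hd).1
      rw [div_right_comm x (d : ℝ) a, div_right_comm x (d : ℝ) b]
      field_simp
  · refine ((tendsto_divisorSum_div k ha).mul (tendsto_divisorSum_div k hb)).congr' ?_
    filter_upwards [eventually_gt_atTop 0] with x hx
    rw [div_mul_div_comm, div_div]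
    congr 1
    ring
  · intro U
    refine ⟨divisorSum (k + 1) (U / a) * divisorSum (k + 1) (U / b), fun u hu hU => ?_⟩
    have hn := fun y => divisorSum_nonneg (k + 1) y
    have hu0 : 0 < u := by linarith
    rw [abs_of_nonneg (div_nonneg (mul_nonneg (hn _) (hn _)) hu0.le)]
    refine (div_le_self (mul_nonneg (hn _) (hn _)) hu).trans ?_
    exact mul_le_mul (divisorSum_mono _ (by gcongr)) (divisorSum_mono _ (by gcongr)) (hn _) (hn _)

/-! ### Mean values of convolutions. -/

namespace BiArith

/-- Terms with `a > x` or `b > y` have empty inner sums, so the ranges may be enlarged freely. A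
common range lets a diagonal `g` collapse to a single sum. -/
theorem partialSum_mul_of_le (g h : BiArith) {x y : ℝ} {A B : ℕ} (hA : ⌊x⌋₊ ≤ A) (hB : ⌊y⌋₊ ≤ B) :
    (g * h).partialSum x y = ∑ a ∈ Finset.Icc 1 A, ∑ b ∈ Finset.Icc 1 B,
      g a b * h.partialSum (x / a) (y / b) := by
  have hzero : ∀ (z : ℝ) (a : ℕ), ⌊z⌋₊ < a → ⌊z / a⌋₊ = 0 := fun z a ha => by
    rw [Nat.floor_div_natCast, Nat.div_eq_of_lt ha]
  calc (g * h).partialSum x y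
      = ∑ a ∈ Finset.Icc 1 ⌊x⌋₊, ∑ b ∈ Finset.Icc 1 ⌊y⌋₊, g a b * h.partialSum (x / a) (y / b) := by
        simp only [partialSum, mul_apply_apply, Nat.floor_div_natCast]
        have hin : ∀ m : ℕ, ∑ n ∈ Finset.Icc 1 ⌊y⌋₊, ∑ p ∈ m.divisorsAntidiagonal,
            ∑ q ∈ n.divisorsAntidiagonal, g p.1 q.1 * h p.2 q.2 =
            ∑ p ∈ m.divisorsAntidiagonal, ∑ b ∈ Finset.Icc 1 ⌊y⌋₊,
              ∑ n ∈ Finset.Icc 1 (⌊y⌋₊ / b), g p.1 b * h p.2 n := fun m => by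
          rw [Finset.sum_comm]
          exact Finset.sum_congr rfl fun p _ =>
            Nat.sum_sum_divisorsAntidiagonal ⌊y⌋₊ fun i j => g p.1 i * h p.2 j
        simp only [hin]
        rw [Nat.sum_sum_divisorsAntidiagonal ⌊x⌋₊ fun i j => ∑ b ∈ Finset.Icc 1 ⌊y⌋₊,
              ∑ n ∈ Finset.Icc 1 (⌊y⌋₊ / b), g i b * h j n]
        refine Finset.sum_congr rfl fun a _ => ?_
        rw [Finset.sum_comm]
        simp only [Finset.mul_sum]
    _ = _ := by
        refine Finset.sum_subset_zero_on_sdiff (Finset.Icc_subset_Icc le_rfl hA) ?_ fun a _ => ?_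
        · intro a ha
          simp only [Finset.mem_sdiff, Finset.mem_Icc, not_and, not_le] at ha
          refine Finset.sum_eq_zero fun b _ => ?_
          simp [partialSum, hzero x a (ha.2 ha.1.1)]
        · refine Finset.sum_subset_zero_on_sdiff (Finset.Icc_subset_Icc le_rfl hB) ?_ fun b _ => rfl
          intro b hb
          simp only [Finset.mem_sdiff, Finset.mem_Icc, not_and, not_le] at hb
          simp [partialSum, hzero y b (hb.2 hb.1.1)]

/-- The index set no longer depends on `x` and `y`, as dominated convergence requires. -/
theorem partialSum_mul_eq_tsum (g h : BiArith) (x y : ℝ) :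
    (g * h).partialSum x y = ∑' q : ℕ × ℕ, g q.1 q.2 * h.partialSum (x / q.1) (y / q.2) := by
  rw [tsum_eq_sum (s := Finset.Icc 1 ⌊x⌋₊ ×ˢ Finset.Icc 1 ⌊y⌋₊), Finset.sum_product,
    partialSum_mul_of_le g h le_rfl le_rfl]
  rintro ⟨a, b⟩ hab
  simp only [Finset.mem_product, Finset.mem_Icc, not_and_or, not_le, Nat.lt_one_iff] at hab
  rcases hab with (rfl | h') | (rfl | h')
  · simp [apply_zero_left]
  · simp [partialSum, Nat.floor_div_natCast, Nat.div_eq_of_lt h']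
  · simp [apply_zero_right]
  · simp [partialSum, Nat.floor_div_natCast, Nat.div_eq_of_lt h']

/-- The mean value of `g * h` when the double series of `g` converges absolutely. -/
theorem tendsto_partialSum_mul {ι : Type*} {l : Filter ι} {g h : BiArith} (hs : Summable g.wt)
    {X Y : ι → ℝ} {N : ι → ℂ} {c : ℂ} {C : ℝ}
    (hbound : ∀ᶠ z in l, ∀ a b : ℕ, 0 < a → 0 < b →
      ‖h.partialSum (X z / a) (Y z / b) / N z‖ ≤ C / (a * b))
    (hlim : ∀ a b : ℕ, 0 < a → 0 < b →
      Tendsto (fun z => h.partialSum (X z / a) (Y z / b) / N z) l (𝓝 (c / (a * b)))) :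
    Tendsto (fun z => (g * h).partialSum (X z) (Y z) / N z) l (𝓝 (c * ∑' q, g.wt q)) := by
  have heq : ∀ z, (g * h).partialSum (X z) (Y z) / N z =
      ∑' q : ℕ × ℕ, g q.1 q.2 * (h.partialSum (X z / q.1) (Y z / q.2) / N z) := fun z => by
    rw [partialSum_mul_eq_tsum, ← tsum_div_const]
    exact tsum_congr fun q => by rw [mul_div_assoc]
  simp only [heq, ← tsum_mul_left]
  have hzero : ∀ q : ℕ × ℕ, ¬(0 < q.1 ∧ 0 < q.2) → g q.1 q.2 = 0 := by
    rintro ⟨a, b⟩ h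
    simp only [not_and_or, not_lt, Nat.le_zero] at h
    rcases h with rfl | rfl
    · exact apply_zero_left _ _
    · exact apply_zero_right _ _
  refine tendsto_tsum_of_dominated_convergence (bound := fun q => C * ‖g.wt q‖)
    (hs.norm.mul_left C) (fun q => ?_) ?_
  · by_cases hq : 0 < q.1 ∧ 0 < q.2
    · have := (hlim q.1 q.2 hq.1 hq.2).const_mul (g q.1 q.2)
      convert this using 2
      rw [wt]
      ring
    · simpa [wt, hzero q hq] using tendsto_const_nhds
  · filter_upwards [hbound] with z hz q
    by_cases hq : 0 < q.1 ∧ 0 < q.2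
    · have hw : ‖g.wt q‖ = ‖g q.1 q.2‖ / (q.1 * q.2) := by
        rw [wt, norm_div, norm_mul, Complex.norm_natCast, Complex.norm_natCast]
      rw [norm_mul, hw]
      calc _ ≤ ‖g q.1 q.2‖ * (C / (q.1 * q.2)) :=
            mul_le_mul_of_nonneg_left (hz q.1 q.2 hq.1 hq.2) (norm_nonneg _)
        _ = _ := by ring
    · simp [wt, hzero q hq]

theorem zetaC_pow_apply (k n : ℕ) :
    (zetaC ^ k) n = ((((ArithmeticFunction.zeta : ArithmeticFunction ℕ) ^ k) n : ℕ) : ℂ) := by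
  have h : zetaC ^ k = (((ArithmeticFunction.zeta : ArithmeticFunction ℕ) ^ k :
      ArithmeticFunction ℕ) : ArithmeticFunction ℂ) := by
    induction k with
    | zero => simp
    | succ k ih => rw [pow_succ, pow_succ, ih, ArithmeticFunction.natCoe_mul]; rfl
  rw [h, ArithmeticFunction.natCoe_apply]

theorem partialSum_tau (k : ℕ) (x y : ℝ) :
    (tau k).partialSum x y = ((divisorSum k x * divisorSum k y : ℝ) : ℂ) := by
  rw [tau, ones_eq_outer, outer_pow, partialSum, divisorSum, divisorSum, Finset.sum_mul_sum]
  push_cast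
  simp only [outer_apply, zetaC_pow_apply]

theorem partialSum_diag_idC_mul_tau (k : ℕ) {x X Y : ℝ} (hX : X ≤ x) (hY : Y ≤ x) :
    (diag idC * tau k).partialSum X Y = ((∑ d ∈ Finset.Icc 1 ⌊x⌋₊,
      d * (divisorSum k (X / d) * divisorSum k (Y / d)) : ℝ) : ℂ) := by
  rw [partialSum_mul_of_le _ _ (Nat.floor_mono hX) (Nat.floor_mono hY)]
  push_cast
  refine Finset.sum_congr rfl fun a ha => ?_
  simp only [diag_apply, ite_mul, zero_mul]
  rw [Finset.sum_ite_eq, if_pos ha, idC_apply, partialSum_tau]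
  push_cast
  rfl

/-- Uniform in `a`, including `a > x`, where the left side is zero. -/
theorem divisorSum_div_le (k : ℕ) {x : ℝ} (hx : 1 ≤ x) {a : ℕ} (ha : 0 < a) :
    divisorSum (k + 1) (x / a) ≤ x * (1 + Real.log x) ^ k / a := by
  have ha' : (1 : ℝ) ≤ a := by exact_mod_cast ha
  have hl := Real.log_nonneg hx
  rcases le_or_gt 1 (x / a) with h | h
  · have hlog : Real.log (x / a) ≤ Real.log x :=
      Real.log_le_log (by positivity) (div_le_self (by linarith) ha')
    have hlog0 := Real.log_nonneg h
    calc _ ≤ x / a * (1 + Real.log (x / a)) ^ k := divisorSum_succ_le k h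
      _ ≤ x / a * (1 + Real.log x) ^ k := by gcongr
      _ = _ := by ring
  · rw [divisorSum_of_lt_one _ h]
    positivity

theorem divisorSum_div_le' (k : ℕ) {x : ℝ} (hx : 1 ≤ x) (hl : 1 ≤ Real.log x) {a : ℕ}
    (ha : 0 < a) : divisorSum (k + 1) (x / a) ≤ 2 ^ k * (x * Real.log x ^ k) / a := by
  refine (divisorSum_div_le k hx ha).trans ?_
  have : (1 + Real.log x) ^ k ≤ (2 * Real.log x) ^ k :=
    pow_le_pow_left₀ (by linarith) (by linarith) k
  rw [mul_pow] at this
  calc x * (1 + Real.log x) ^ k / a ≤ x * (2 ^ k * Real.log x ^ k) / a := by gcongr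
    _ = _ := by ring

theorem eventually_one_le_log : ∀ᶠ x : ℝ in atTop, 1 ≤ x ∧ 1 ≤ Real.log x :=
  (eventually_ge_atTop 1).and (Real.tendsto_log_atTop.eventually_ge_atTop 1)

theorem tendsto_partialSum_mul_tau (k : ℕ) {g : BiArith} (hs : Summable g.wt) :
    Tendsto (fun z : ℝ × ℝ => (g * tau (k + 1)).partialSum z.1 z.2 /
        ((z.1 * z.2 * (Real.log z.1 * Real.log z.2) ^ k : ℝ) : ℂ)) (atTop ×ˢ atTop)
      (𝓝 (1 / ((k.factorial : ℂ) ^ 2) * ∑' q, g.wt q)) := by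
  -- The normalised sum is a product of a function of `x` and a function of `y`, so the two
  -- variables may tend to infinity independently.
  have hsplit : ∀ (z : ℝ × ℝ) (a b : ℕ), (tau (k + 1)).partialSum (z.1 / a) (z.2 / b) /
      ((z.1 * z.2 * (Real.log z.1 * Real.log z.2) ^ k : ℝ) : ℂ) =
      ((divisorSum (k + 1) (z.1 / a) / (z.1 * Real.log z.1 ^ k) *
        (divisorSum (k + 1) (z.2 / b) / (z.2 * Real.log z.2 ^ k)) : ℝ) : ℂ) := fun z a b => by
    rw [partialSum_tau, ← Complex.ofReal_div, div_mul_div_comm, mul_pow]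
    congr 2
    ring
  refine tendsto_partialSum_mul hs (C := 2 ^ k * 2 ^ k) ?_ fun a b ha hb => ?_
  · filter_upwards [eventually_one_le_log.prod_mk eventually_one_le_log]
      with z ⟨⟨hx, hlx⟩, ⟨hy, hly⟩⟩ a b ha hb
    have h1 : ∀ {x : ℝ} {a : ℕ}, 1 ≤ x → 1 ≤ Real.log x → 0 < a →
        0 ≤ divisorSum (k + 1) (x / a) / (x * Real.log x ^ k) ∧
        divisorSum (k + 1) (x / a) / (x * Real.log x ^ k) ≤ 2 ^ k / a := fun {x a} hx hl ha => by
      have hpos : 0 < x * Real.log x ^ k := by positivity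
      refine ⟨div_nonneg (divisorSum_nonneg _ _) hpos.le, ?_⟩
      rw [div_le_iff₀ hpos]
      refine (divisorSum_div_le' k hx hl ha).trans_eq ?_
      ring
    obtain ⟨h2, h3⟩ := h1 hx hlx ha
    obtain ⟨h4, h5⟩ := h1 hy hly hb
    rw [hsplit, Complex.norm_real, Real.norm_of_nonneg (mul_nonneg h2 h4), ← div_mul_div_comm]
    exact mul_le_mul h3 h5 h4 (h2.trans h3)
  · simp only [hsplit]
    have h := ((tendsto_divisorSum_div k (a := a) (by exact_mod_cast ha)).comp
      (tendsto_fst (f := atTop) (g := (atTop : Filter ℝ)))).mul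
      ((tendsto_divisorSum_div k (a := b) (by exact_mod_cast hb)).comp
      (tendsto_snd (f := (atTop : Filter ℝ)) (g := atTop)))
    have h' := (Complex.continuous_ofReal.tendsto _).comp h
    rw [show ((1 / (k.factorial : ℝ) / a * (1 / (k.factorial : ℝ) / b) : ℝ) : ℂ) =
      1 / (k.factorial : ℂ) ^ 2 / (a * b) by push_cast; ring] at h'
    exact h'

theorem tendsto_partialSum_mul_diag_idC_mul_tau (k : ℕ) {g : BiArith} (hs : Summable g.wt) :
    Tendsto (fun x : ℝ => (g * (diag idC * tau (k + 1))).partialSum x x /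
        ((x ^ 2 * Real.log x ^ (2 * k + 1) : ℝ) : ℂ)) atTop
      (𝓝 (1 / ((k.factorial : ℂ) ^ 2 * (2 * k + 1)) * ∑' q, g.wt q)) := by
  have hle : ∀ {x : ℝ} {a : ℕ}, 0 ≤ x → 0 < a → x / a ≤ x := fun hx ha =>
    div_le_self hx (by exact_mod_cast ha)
  refine tendsto_partialSum_mul hs (C := 2 ^ k * 2 ^ k * 2) ?_ fun a b ha hb => ?_
  · filter_upwards [eventually_one_le_log] with x ⟨hx, hl⟩ a b ha hb
    have hx0 : 0 ≤ x := by linarith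
    have hpos : 0 < x ^ 2 * Real.log x ^ (2 * k + 1) := by positivity
    rw [partialSum_diag_idC_mul_tau _ (hle hx0 ha) (hle hx0 hb), ← Complex.ofReal_div,
      Complex.norm_real, Real.norm_of_nonneg (div_nonneg (Finset.sum_nonneg fun d _ =>
        mul_nonneg (Nat.cast_nonneg _) (mul_nonneg (divisorSum_nonneg _ _)
          (divisorSum_nonneg _ _))) hpos.le), div_le_iff₀ hpos]
    have ha0 : (0 : ℝ) < a := by exact_mod_cast ha
    have hb0 : (0 : ℝ) < b := by exact_mod_cast hb
    set W : ℝ := 2 ^ k * (x * Real.log x ^ k) with hW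
    have hW0 : 0 ≤ W := by positivity
    -- Each term is at most `d (W/(ad)) (W/(bd)) = W² / (abd)`. The harmonic sum is at most `1 + log
    -- x ≤ 2 log x`, which gives the last factor `2` of `C`.
    calc ∑ d ∈ Finset.Icc 1 ⌊x⌋₊,
          d * (divisorSum (k + 1) (x / a / d) * divisorSum (k + 1) (x / b / d))
        ≤ ∑ d ∈ Finset.Icc 1 ⌊x⌋₊, W * W / (a * b) * (Real.log (x / d) ^ 0 / d) := by
          refine Finset.sum_le_sum fun d hd => ?_
          have hd1 := (Finset.mem_Icc.1 hd).1
          have hd0 : (0 : ℝ) < d := by exact_mod_cast hd1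
          have h1 := divisorSum_div_le' k hx hl (Nat.mul_pos ha hd1)
          have h2 := divisorSum_div_le' k hx hl (Nat.mul_pos hb hd1)
          push_cast at h1 h2
          rw [← div_div] at h1 h2
          calc _ ≤ d * (W / (a * d) * (W / (b * d))) :=
                mul_le_mul_of_nonneg_left (mul_le_mul h1 h2 (divisorSum_nonneg _ _)
                  (by positivity)) hd0.le
            _ = _ := by rw [pow_zero]; field_simp
      _ = W * W / (a * b) * logSum 0 x := by rw [← Finset.mul_sum]; rfl
      _ ≤ W * W / (a * b) * (2 * Real.log x) := by
          have h := logSum_le 0 hx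
          gcongr
          simp at h
          linarith
      _ = _ := by rw [hW]; ring
  · have h := tendsto_sum_mul_divisorSum k (a := a) (b := b) (by exact_mod_cast ha)
      (by exact_mod_cast hb)
    have h' := (Complex.continuous_ofReal.tendsto _).comp h
    push_cast at h'
    refine h'.congr' ?_
    filter_upwards [eventually_ge_atTop 0] with x hx
    rw [partialSum_diag_idC_mul_tau _ (hle hx ha) (hle hx hb), Function.comp_apply,
      Complex.ofReal_div]

/-- On the diagonal the weight is `1/n²`; this is what allows `diag μ` to be absorbed into `g`. -/
theorem summable_wt_diag_moebiusC : Summable (diag moebiusC).wt := by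
  have hinj : Function.Injective fun i : ℕ => (i, i) := fun i j h => (Prod.mk.inj h).1
  rw [← hinj.summable_iff]
  · refine Summable.of_norm_bounded (g := fun n : ℕ => 1 / (n : ℝ) ^ 2)
      (Real.summable_one_div_nat_pow.2 one_lt_two) fun n => ?_
    have hmu : ‖moebiusC n‖ ≤ 1 := by
      rw [moebiusC, ArithmeticFunction.intCoe_apply, Complex.norm_intCast]
      exact_mod_cast ArithmeticFunction.abs_moebius_le_one
    rw [Function.comp_apply, wt, diag_apply, if_pos rfl, norm_div, ← pow_two, norm_pow,
      Complex.norm_natCast]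
    gcongr
  · rintro ⟨i, j⟩ hij
    rw [wt, diag_apply, if_neg, zero_div]
    intro h
    exact hij ⟨i, Prod.ext rfl h⟩

end BiArith

end

theorem theorem3 (f : BiArith) (hf : f.IsMultiplicativeTwo) (k : ℕ) (hk : 1 ≤ k) :
    ((f * BiArith.mu k).PrimePowerSummable →
      (∀ p : Nat.Primes, Summable (f.localTerm p)) ∧
      Multipliable (fun p : Nat.Primes =>
        (1 - 1 / ((p : ℕ) : ℂ)) ^ (2 * k) * ∑' ν : ℕ × ℕ, f.localTerm p ν) ∧
      Tendsto
        (fun z : ℝ × ℝ => f.partialSum z.1 z.2 /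
          ((z.1 * z.2 * (Real.log z.1 * Real.log z.2) ^ (k - 1) : ℝ) : ℂ))
        (atTop ×ˢ atTop)
        (𝓝 (1 / ((Nat.factorial (k - 1) : ℂ) ^ 2) *
          ∏' p : Nat.Primes,
            ((1 - 1 / ((p : ℕ) : ℂ)) ^ (2 * k) * ∑' ν : ℕ × ℕ, f.localTerm p ν)))) ∧
    ((f * BiArith.muTilde k).PrimePowerSummable →
      (∀ p : Nat.Primes, Summable (f.localTerm p)) ∧
      Multipliable (fun p : Nat.Primes =>
        (1 - 1 / ((p : ℕ) : ℂ)) ^ (2 * k + 1) * ∑' ν : ℕ × ℕ, f.localTerm p ν) ∧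
      Tendsto
        (fun x : ℝ => f.partialSum x x / ((x ^ 2 * Real.log x ^ (2 * k - 1) : ℝ) : ℂ))
        atTop
        (𝓝 (1 / ((Nat.factorial (k - 1) : ℂ) ^ 2 * (2 * (k : ℂ) - 1)) *
          ∏' p : Nat.Primes,
            ((1 - 1 / ((p : ℕ) : ℂ)) ^ (2 * k + 1) * ∑' ν : ℕ × ℕ, f.localTerm p ν)))) := by
  obtain ⟨m, rfl⟩ := Nat.exists_eq_add_of_le' hk
  have htau : ∀ p : ℕ, p.Prime →
      HasSum ((BiArith.tau (m + 1)).localTerm p) ((1 - 1 / (p : ℂ))⁻¹ ^ (2 * (m + 1))) :=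
    fun p hp => by
      rw [pow_mul]
      exact BiArith.hasSum_localTerm_pow hp (BiArith.hasSum_localTerm_ones hp) (m + 1)
  constructor
  · intro h
    have hg := hf.mul (BiArith.isMultiplicativeTwo_mu (m + 1))
    have hs := h.summable_wt hg
    have heq : f = f * BiArith.mu (m + 1) * BiArith.tau (m + 1) := by
      rw [mul_assoc, BiArith.mu_mul_tau, mul_one]
    obtain ⟨h1, h2⟩ := BiArith.hasProd_localTerm_of_eq_mul hg hs heq htau
    refine ⟨h1, h2.multipliable, ?_⟩
    rw [h2.tprod_eq, Nat.add_sub_cancel]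
    have h3 := BiArith.tendsto_partialSum_mul_tau m hs
    rwa [← heq] at h3
  · intro h
    have hg := (hf.mul (BiArith.isMultiplicativeTwo_muTilde hk)).mul
      (BiArith.isMultiplicativeTwo_diag BiArith.isMultiplicative_moebiusC)
    have hs : Summable (f * BiArith.muTilde (m + 1) * BiArith.diag BiArith.moebiusC).wt :=
      (BiArith.hasSum_wt_mul (h.summable_wt (hf.mul
        (BiArith.isMultiplicativeTwo_muTilde hk))).hasSum
        BiArith.summable_wt_diag_moebiusC.hasSum).summable
    -- Here `g = f * μ̃_k * diag μ`; the remaining factor `diag id * τ_k` has local sum `(1 -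
    -- 1/p)^(-(2k+1))`.
    have heq : f = f * BiArith.muTilde (m + 1) * BiArith.diag BiArith.moebiusC *
        (BiArith.diag BiArith.idC * BiArith.tau (m + 1)) := by
      rw [mul_assoc _ (BiArith.diag BiArith.moebiusC), ← BiArith.tauTilde_eq hk, mul_assoc,
        BiArith.muTilde_mul_tauTilde, mul_one]
    obtain ⟨h1, h2⟩ := BiArith.hasProd_localTerm_of_eq_mul (r := 2 * (m + 1) + 1) hg hs heq
      fun p hp => by
        rw [pow_succ']
        exact BiArith.hasSum_localTerm_mul hp (BiArith.hasSum_localTerm_diag_idC hp) (htau p hp)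
    refine ⟨h1, h2.multipliable, ?_⟩
    rw [h2.tprod_eq, Nat.add_sub_cancel]
    have h3 := BiArith.tendsto_partialSum_mul_diag_idC_mul_tau m hs
    rw [← heq] at h3
    rw [show 2 * (m + 1) - 1 = 2 * m + 1 by omega,
      show 2 * ((m + 1 : ℕ) : ℂ) - 1 = 2 * m + 1 by push_cast; ring]
    exact h3
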